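/- Let $n\ge 2$ and let $H\in C^0(\mathbb R^n)$ be convex and coercive, i.e. $H(p)\to\infty$ as $|p|\to\infty$. Assume (A): for every $c\in\mathbb R$ the level set $H^{-1}(c)$ contains no line segment $[a,b]$ with $a\ne b$. For an open set $V\subset\mathbb R^n$ and $v\in W^{1,\infty}_{\rm loc}(V)$ put $$\mathcal F_H(v,V)=\operatorname*{ess\,sup}_{x\in V}H(Dv(x))\in[-\infty,\infty],$$ where $Dv$ is the weak gradient of $v$ on $V$. Let $\Omega\subset\mathbb R^n$ be open and let $u\in AM_H(\Omega)$ be an absolute minimizer of $H$, that is, $u\in W^{1,\infty}_{\rm loc}(\Omega)$ (represented by a continuous function) and $\mathcal F_H(u,V)\le\mathcal F_H(v,V)$ whenever $V$ is open, $\overline V$ is a compact subset of $\Omega$, and $v\in W^{1,\infty}_{\rm loc}(V)\cap C(\overline V)$ satisfies $v=u$ on $\partial V$. Then for every $x\in\Omega$ the following hold. 1. (Linear approximation property.) For every sequence of positive numbers $r_i\to0$ there are a subsequence $(r_{i_k})$ and a vector $e\in\mathbb R^n$ such that $$\lim_{k\to\infty}\ \sup_{y\in B(0,1)}\Big|\frac{u(x+r_{i_k}y)-u(x)}{r_{i_k}}-e\cdot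 y\Big|=0.$$ 2. Let $\mathscr Du(x)$ be the set of all $e\in\mathbb R^n$ for which there is a sequence of positive numbers $r_k\to0$ with $\lim_{k\to\infty}\sup_{y\in B(0,1)}\big|\frac{u(x+r_ky)-u(x)}{r_k}-e\cdot y\big|=0$. Then for every $e\in\mathscr Du(x)$ $$H(e)=\lim_{r\to0^+}\ \operatorname*{ess\,sup}_{B_r(x)}H(Du).$$ (If $H\ge0$, the right-hand side is $\lim_{r\to0^+}\|H(Du)\|_{L^\infty(B_r(x))}$.) -/

import Mathlib

open MeasureTheory Filter Topology Set

open scoped ContDiff ENNReal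

noncomputable section

namespace AbsMin

/-- The Euclidean space `ℝⁿ`. -/
abbrev E (n : ℕ) : Type := EuclideanSpace ℝ (Fin n)

/-- `G` is a weak gradient of `v` on the open set `V`: both are locally integrable on `V`, and
`∫_V v ∂ᵢφ = - ∫_V Gᵢ φ` for all test functions `φ ∈ C_c^∞(V)` and all `i`. -/
def HasWeakGradient {n : ℕ} (v : E n → ℝ) (G : E n → E n) (V : Set (E n)) : Prop :=
  LocallyIntegrableOn v V volume ∧ LocallyIntegrableOn G V volume ∧
    ∀ φ : E n → ℝ, ContDiff ℝ ∞ φ → HasCompactSupport φ → tsupport φ ⊆ V →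
      ∀ i : Fin n,
        ∫ x in V, v x * fderiv ℝ φ x (EuclideanSpace.single i 1) = -∫ x in V, G x i * φ x

/-- `f ∈ L^∞_loc(V)`. -/
def MemLinftyLoc {n : ℕ} {F : Type*} [NormedAddCommGroup F] (f : E n → F) (V : Set (E n)) :
    Prop :=
  ∀ K : Set (E n), IsCompact K → K ⊆ V → MemLp f ∞ (volume.restrict K)

/-- `v ∈ W^{1,∞}_loc(V)`. -/
def MemW1inftyLoc {n : ℕ} (v : E n → ℝ) (V : Set (E n)) : Prop :=
  MemLinftyLoc v V ∧ ∃ G : E n → E n, HasWeakGradient v G V ∧ MemLinftyLoc G V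

open Classical in
/-- The weak gradient `Dv` of `v` on `V`, which is unique up to null sets
(zero if there is none). -/
def weakGrad {n : ℕ} (v : E n → ℝ) (V : Set (E n)) : E n → E n :=
  if h : ∃ G : E n → E n, HasWeakGradient v G V then h.choose else 0

/-- The functional `F_H(v, V) = ess sup_{x ∈ V} H(Dv(x))`, with values in `[-∞, ∞]`. -/
def supFunctional {n : ℕ} (H : E n → ℝ) (v : E n → ℝ) (V : Set (E n)) : EReal :=
  essSup (fun x => ((H (weakGrad v V x) : ℝ) : EReal)) (volume.restrict V)

/-- `u ∈ AM_H(Ω)`. Functions in `W^{1,∞}_loc(Ω)` are identified with their continuous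
representatives. -/
structure IsAbsoluteMinimizer {n : ℕ} (H : E n → ℝ) (Ω : Set (E n)) (u : E n → ℝ) : Prop where
  continuousOn : ContinuousOn u Ω
  memW1inftyLoc : MemW1inftyLoc u Ω
  le_of_eq_on_frontier : ∀ V : Set (E n), IsOpen V → IsCompact (closure V) → closure V ⊆ Ω →
    ∀ v : E n → ℝ, MemW1inftyLoc v V → ContinuousOn v (closure V) →
      (∀ x ∈ frontier V, v x = u x) →
        supFunctional H u V ≤ supFunctional H v V

/-- Along the scales `r k`, the rescalings of `u` at `x` converge uniformly on the open unit ball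
to the linear function `y ↦ e · y`. -/
def LinearApproxAlong {n : ℕ} (u : E n → ℝ) (x : E n) (r : ℕ → ℝ) (e : E n) : Prop :=
  Tendsto (fun k => ⨆ y ∈ Metric.ball (0 : E n) 1,
    ENNReal.ofReal |(u (x + r k • y) - u x) / r k - inner ℝ e y|) atTop (𝓝 0)

/-- The linear approximation property of `u` at the point `x`: every sequence of positive radii tending
to zero has a subsequence along which `u` has a linear approximation at `x`. -/
def LinearApproxPropertyAt {n : ℕ} (u : E n → ℝ) (x : E n) : Prop :=
  ∀ r : ℕ → ℝ, (∀ i, 0 < r i) → Tendsto r atTop (𝓝 0) →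
    ∃ φ : ℕ → ℕ, StrictMono φ ∧ ∃ e : E n, LinearApproxAlong u x (r ∘ φ) e

/-- The set `𝒟u(x)` of the slopes of all linear approximations of `u` at `x`. -/
def blowUpSlopes {n : ℕ} (u : E n → ℝ) (x : E n) : Set (E n) :=
  {e | ∃ r : ℕ → ℝ, (∀ i, 0 < r i) ∧ Tendsto r atTop (𝓝 0) ∧ LinearApproxAlong u x r e}

end AbsMin

end

/-! Write `L_k` for the support function of the compact convex set `{H ≤ k}`. On a ball, `H(Du) ≤ k`
almost everywhere is equivalent to `u y - u z ≤ L_k (y - z)` for all `y, z` in the ball: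
mollification gives one direction, Rademacher's theorem and Hahn–Banach separation the other. Hence
the infimum `κ` of the levels `k` admissible near `x` is the limit of the essential suprema of
`H(Du)` over shrinking balls (`tendsto_supFunctional_ball`).

Absolute minimality gives comparison with the cones `u x' + L_k (· - x')`
(`IsSlopeMinimizer.le_cone`). If `min H < κ`, growth strictly below `L_κ` on one sphere around `x`
would, by comparison, make a level below `κ` admissible. So every small sphere carries a point where
`u` grows at least like `L_κ` (`IsSlopeMinimizer.exists_mem_sphere`), and by reflection the same
holds for `-u`.

A blow-up limit `v` satisfies `v y - v z ≤ L_κ (y - z)` and inherits this growth on all spheres,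
hence along a whole ray (`exists_ray`), from above and from below. Playing the two rays against each
other gives one `e` with `H e = κ` that maximizes the pairing with both directions. By (A) this
maximizer is unique, which forces `v` to lie above and below `e · y` (`inner_le_of_ray`,
`exists_eq_inner_of_rays`). If `κ = min H`, then (A) makes `{H ≤ κ}` a single point and linearity is
immediate. All blow-ups at `x` thus have slope on `{H = κ}`, which yields both claims. -/

noncomputable section

namespace AbsMin

/-! ### Support functions of compact sets -/

section SupportFunction

variable {F : Type*} [NormedAddCommGroup F] [InnerProductSpace ℝ F]

/-- The support function `q ↦ sup_{p ∈ K} p · q` of the set `K`. -/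
def supportFun (K : Set F) (q : F) : ℝ := sSup ((fun p => inner ℝ p q) '' K)

variable {K : Set F}

lemma isCompact_image_inner (hK : IsCompact K) (q : F) :
    IsCompact ((fun p => inner ℝ p q) '' K) :=
  hK.image (by fun_prop)

lemma inner_le_supportFun (hK : IsCompact K) {p : F} (hp : p ∈ K) (q : F) :
    inner ℝ p q ≤ supportFun K q :=
  le_csSup (isCompact_image_inner hK q).bddAbove ⟨p, hp, rfl⟩

lemma exists_inner_eq_supportFun (hK : IsCompact K) (hne : K.Nonempty) (q : F) :
    ∃ p ∈ K, inner ℝ p q = supportFun K q :=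
  (isCompact_image_inner hK q).sSup_mem (hne.image _)

lemma supportFun_le (hne : K.Nonempty) {q : F} {c : ℝ} (h : ∀ p ∈ K, inner ℝ p q ≤ c) :
    supportFun K q ≤ c :=
  csSup_le (hne.image _) (by rintro _ ⟨p, hp, rfl⟩; exact h p hp)

lemma supportFun_zero (hK : IsCompact K) (hne : K.Nonempty) : supportFun K 0 = 0 := by
  obtain ⟨p, -, h⟩ := exists_inner_eq_supportFun hK hne 0
  simpa using h.symm

lemma supportFun_smul (hK : IsCompact K) (hne : K.Nonempty) {t : ℝ} (ht : 0 ≤ t) (q : F) :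
    supportFun K (t • q) = t * supportFun K q := by
  apply le_antisymm
  · refine supportFun_le hne fun p hp => ?_
    rw [inner_smul_right]
    exact mul_le_mul_of_nonneg_left (inner_le_supportFun hK hp q) ht
  · obtain ⟨p, hp, h⟩ := exists_inner_eq_supportFun hK hne q
    rw [← h, ← inner_smul_right]
    exact inner_le_supportFun hK hp _

lemma supportFun_add_le (hK : IsCompact K) (hne : K.Nonempty) (q q' : F) :
    supportFun K (q + q') ≤ supportFun K q + supportFun K q' := by
  refine supportFun_le hne fun p hp => ?_
  rw [inner_add_right]
  exact add_le_add (inner_le_supportFun hK hp q) (inner_le_supportFun hK hp q')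

lemma supportFun_mono {K' : Set F} (hK' : IsCompact K') (hne : K.Nonempty) (h : K ⊆ K') (q : F) :
    supportFun K q ≤ supportFun K' q :=
  supportFun_le hne fun _ hp => inner_le_supportFun hK' (h hp) q

lemma exists_supportFun_le_mul_norm (hK : IsCompact K) (hne : K.Nonempty) :
    ∃ C : ℝ, 0 < C ∧ ∀ q, supportFun K q ≤ C * ‖q‖ := by
  obtain ⟨C, hC, h⟩ := hK.isBounded.exists_pos_norm_le
  refine ⟨C, hC, fun q => supportFun_le hne fun p hp => ?_⟩
  exact (real_inner_le_norm p q).trans (mul_le_mul_of_nonneg_right (h p hp) (norm_nonneg q))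

omit [InnerProductSpace ℝ F] in
lemma abs_sub_le_of_sub_le {L : F → ℝ} {C : ℝ} (hL : ∀ q, L q ≤ C * ‖q‖) {a b : ℝ} {y z : F}
    (h₁ : a - b ≤ L (y - z)) (h₂ : b - a ≤ L (z - y)) : |a - b| ≤ C * ‖y - z‖ := by
  have h₃ := hL (z - y)
  rw [norm_sub_rev] at h₃
  exact abs_sub_le_iff.2 ⟨h₁.trans (hL _), h₂.trans h₃⟩

lemma supportFun_sub_le (hK : IsCompact K) (hne : K.Nonempty) (q q' : F) :
    supportFun K q - supportFun K q' ≤ supportFun K (q - q') := by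
  have := supportFun_add_le hK hne q' (q - q')
  rw [add_sub_cancel] at this
  linarith

lemma exists_lipschitzWith_of_sub_le (hK : IsCompact K) (hne : K.Nonempty) :
    ∃ C : NNReal, ∀ (v : F → ℝ) (s : Set F),
      (∀ y ∈ s, ∀ z ∈ s, v y - v z ≤ supportFun K (y - z)) → LipschitzOnWith C v s := by
  obtain ⟨C, hC, h⟩ := exists_supportFun_le_mul_norm hK hne
  refine ⟨⟨C, hC.le⟩, fun v s hv => LipschitzOnWith.of_dist_le_mul fun y hy z hz => ?_⟩
  rw [Real.dist_eq, dist_eq_norm]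
  exact abs_sub_le_of_sub_le h (hv y hy z hz) (hv z hz y hy)

lemma continuous_supportFun (hK : IsCompact K) (hne : K.Nonempty) :
    Continuous (supportFun K) := by
  obtain ⟨C, h⟩ := exists_lipschitzWith_of_sub_le hK hne
  have := h (supportFun K) univ fun y _ z _ => supportFun_sub_le hK hne y z
  exact (lipschitzOnWith_univ.1 this).continuous

/-- A point outside a closed convex set is strictly separated from it, and the separating functional
violates the bound. This turns bounds on directional derivatives into `H (Du) ≤ k`. -/
lemma mem_of_forall_inner_le_supportFun [CompleteSpace F] (hK : IsCompact K) (hne : K.Nonempty)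
    (hconv : Convex ℝ K) {x : F} (h : ∀ q, inner ℝ x q ≤ supportFun K q) : x ∈ K := by
  by_contra hx
  obtain ⟨f, a, hfx, hfa⟩ := geometric_hahn_banach_point_closed hconv hK.isClosed hx
  obtain ⟨p, hp, hpe⟩ := exists_inner_eq_supportFun hK hne (-(InnerProductSpace.toDual ℝ F).symm f)
  have h1 := h (-(InnerProductSpace.toDual ℝ F).symm f)
  rw [← hpe, inner_neg_right, inner_neg_right, real_inner_comm, real_inner_comm _ p,
    InnerProductSpace.toDual_symm_apply, InnerProductSpace.toDual_symm_apply] at h1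
  have := hfa p hp
  linarith

/-- Used for the symmetry `u ↦ -u`, `H ↦ H (-·)`, which turns statements from above into statements
from below. -/
lemma supportFun_setOf_neg_le (H : F → ℝ) (k : ℝ) (q : F) :
    supportFun {p | H (-p) ≤ k} q = supportFun {p | H p ≤ k} (-q) := by
  unfold supportFun
  congr 1
  ext s
  constructor
  · rintro ⟨p, hp, rfl⟩
    exact ⟨-p, hp, by simp⟩
  · rintro ⟨p, hp, rfl⟩
    exact ⟨-p, by simpa using hp, by simp⟩

end SupportFunction

/-! ### Sublevel sets of `H` and assumption (A) -/

section Sublevel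

variable {F : Type*} [NormedAddCommGroup F] [InnerProductSpace ℝ F] {H : F → ℝ}

omit [InnerProductSpace ℝ F] in
lemma isCompact_sublevel [ProperSpace F] (hc : Continuous H)
    (hco : Tendsto H (Bornology.cobounded F) atTop) (k : ℝ) : IsCompact {p | H p ≤ k} := by
  refine Metric.isCompact_of_isClosed_isBounded (isClosed_le hc continuous_const) ?_
  have := hco.eventually (eventually_gt_atTop k)
  rw [← Bornology.isCobounded_compl_iff]
  filter_upwards [this] with p hp
  simpa using hp

/-- A maximizer with `H p < k` could be pushed slightly in direction `a`, staying in the sublevel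
set and increasing the pairing; so maximizers lie on `{H = k}`. Maximizers form a convex set, so two
of them would span a segment in that level set, against (A). -/
lemma eq_of_inner_eq_supportFun (hc : Continuous H) (hconv : ConvexOn ℝ univ H)
    (hA : ∀ c : ℝ, ∀ a b : F, a ≠ b → ¬ segment ℝ a b ⊆ H ⁻¹' {c}) {k : ℝ}
    (hK : IsCompact {p | H p ≤ k}) {a : F} (ha : a ≠ 0) {p : F} (hp : H p ≤ k)
    (hpa : inner ℝ p a = supportFun {p | H p ≤ k} a) :
    H p = k ∧ ∀ p', H p' ≤ k → inner ℝ p' a = supportFun {p | H p ≤ k} a → p' = p := by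
  have key : ∀ p, H p ≤ k → inner ℝ p a = supportFun {p | H p ≤ k} a → H p = k := by
    intro p hp hpa
    by_contra hne
    have hlt : H p < k := lt_of_le_of_ne hp hne
    have ht : Tendsto (fun s : ℝ => H (p + s • a)) (𝓝[>] 0) (𝓝 (H p)) := by
      have : Continuous fun s : ℝ => H (p + s • a) := by fun_prop
      have h := this.tendsto 0
      simp only [zero_smul, add_zero] at h
      exact h.mono_left nhdsWithin_le_nhds
    obtain ⟨s, hs, hs0⟩ := ((ht.eventually (gt_mem_nhds hlt)).and self_mem_nhdsWithin).exists
    have h1 := inner_le_supportFun hK (show p + s • a ∈ {p | H p ≤ k} from hs.le) a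
    rw [inner_add_left, real_inner_smul_left, hpa] at h1
    have h2 : 0 < s * inner ℝ a a := mul_pos hs0 (real_inner_self_pos.2 ha)
    linarith
  refine ⟨key p hp hpa, fun p' hp' hpa' => ?_⟩
  by_contra hne
  refine hA k p' p hne ?_
  have hsub : Convex ℝ {q | H q ≤ k} := by simpa using hconv.convex_le k
  intro q hq
  have hqK : q ∈ {q | H q ≤ k} := hsub.segment_subset hp' hp hq
  refine key q hqK ?_
  obtain ⟨s, t, hs, ht, hst, rfl⟩ := hq
  rw [inner_add_left, real_inner_smul_left, real_inner_smul_left, hpa, hpa', ← add_mul, hst,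
    one_mul]

end Sublevel

/-! ### Comparison with cones and extremal growth on spheres -/

section SlopeMinimizer

variable {F : Type*} [NormedAddCommGroup F] [InnerProductSpace ℝ F]

/-- Comparison form of absolute minimality: on every open `W` relatively compact in `Ω`, if `u`
has on `∂W` the boundary values of a function with `v y - v z ≤ L_k (y - z)`, where `L_k` is the
support function of `{H ≤ k}`, then `u y - u z ≤ L_k (y - z)` along segments in `W`. -/
structure IsSlopeMinimizer (H : F → ℝ) (Ω : Set F) (u : F → ℝ) : Prop where
  continuousOn : ContinuousOn u Ω
  sub_le : ∀ W : Set F, IsOpen W → IsCompact (closure W) → closure W ⊆ Ω →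
    ∀ k : ℝ, {p | H p ≤ k}.Nonempty →
    ∀ v : F → ℝ, (∀ y z, v y - v z ≤ supportFun {p | H p ≤ k} (y - z)) →
      (∀ x ∈ frontier W, v x = u x) →
        ∀ y z, segment ℝ z y ⊆ W → u y - u z ≤ supportFun {p | H p ≤ k} (y - z)

/-- The levels `k` such that `u` is Lipschitz with respect to the support function of `{H ≤ k}`
near `x`. -/
def slopeLevels (H : F → ℝ) (u : F → ℝ) (x : F) : Set ℝ :=
  {k | {p | H p ≤ k}.Nonempty ∧ ∃ r > 0, ∀ y ∈ Metric.ball x r, ∀ z ∈ Metric.ball x r,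
    u y - u z ≤ supportFun {p | H p ≤ k} (y - z)}

variable {H : F → ℝ} {Ω : Set F} {u : F → ℝ} {x : F}

omit [InnerProductSpace ℝ F] in
lemma nonempty_sublevel_neg {k : ℝ} :
    {p | H (-p) ≤ k}.Nonempty ↔ {p | H p ≤ k}.Nonempty :=
  ⟨fun ⟨p, hp⟩ => ⟨-p, hp⟩, fun ⟨p, hp⟩ => ⟨-p, by simpa using hp⟩⟩

lemma IsSlopeMinimizer.neg (h : IsSlopeMinimizer H Ω u) :
    IsSlopeMinimizer (fun p => H (-p)) Ω (fun y => -u y) where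
  continuousOn := h.continuousOn.neg
  sub_le := by
    intro W hW hWc hWΩ k hk v hv hvu y z hyz
    rw [supportFun_setOf_neg_le, neg_sub]
    have := h.sub_le W hW hWc hWΩ k (nonempty_sublevel_neg.1 hk) (fun y => -v y)
      (fun y z => by
        have := hv z y
        rw [supportFun_setOf_neg_le, neg_sub] at this
        linarith) (fun y hy => by simp [hvu y hy]) z y (by rwa [segment_symm])
    linarith

lemma slopeLevels_neg : slopeLevels (fun p => H (-p)) (fun y => -u y) x = slopeLevels H u x := by
  ext k
  refine and_congr nonempty_sublevel_neg (exists_congr fun r => and_congr_right fun _ => ?_)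
  constructor <;> intro h y hy z hz
  · have := h z hz y hy
    rw [supportFun_setOf_neg_le, neg_sub] at this
    linarith
  · have := h z hz y hy
    rw [supportFun_setOf_neg_le, neg_sub]
    linarith

lemma mem_slopeLevels_of_isGLB (hK : ∀ k, IsCompact {p | H p ≤ k}) {κ k : ℝ}
    (hκ : IsGLB (slopeLevels H u x) κ) (hk : κ < k) : k ∈ slopeLevels H u x := by
  obtain ⟨k', ⟨hne, r, hr, h⟩, -, hk'⟩ := hκ.exists_between hk
  have hsub : {p | H p ≤ k'} ⊆ {p | H p ≤ k} := fun p hp => le_trans hp hk'.le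
  exact ⟨hne.mono hsub, r, hr, fun y hy z hz =>
    (h y hy z hz).trans (supportFun_mono (hK k) hne hsub _)⟩

/-- Comparison with cones from above. -/
lemma IsSlopeMinimizer.le_cone [ProperSpace F] (h : IsSlopeMinimizer H Ω u) {r k : ℝ}
    (hΩ : Metric.closedBall x r ⊆ Ω) (hK : IsCompact {p | H p ≤ k})
    (hne : {p | H p ≤ k}.Nonempty) {x' : F}
    (hle : ∀ y ∈ Metric.sphere x r, u y ≤ u x' + supportFun {p | H p ≤ k} (y - x')) :
    ∀ y ∈ Metric.ball x r, u y ≤ u x' + supportFun {p | H p ≤ k} (y - x') := by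
  set L := supportFun {p | H p ≤ k} with hL
  have hLc : Continuous L := continuous_supportFun hK hne
  set cone : F → ℝ := fun y => u x' + L (y - x') with hcone
  have hcc : Continuous cone := by fun_prop
  have huB : ContinuousOn u (Metric.closedBall x r) := h.continuousOn.mono hΩ
  -- Comparison is applied on the set where the claim fails; there the cone itself is the
  -- competitor, since it agrees with `u` on the boundary.
  set W : Set F := Metric.ball x r ∩ {y | cone y < u y} with hWdef
  have hWo : IsOpen W := by
    have h1 : ContinuousOn (fun y => u y - cone y) (Metric.ball x r) :=
      (huB.mono Metric.ball_subset_closedBall).sub hcc.continuousOn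
    have h2 := h1.isOpen_inter_preimage Metric.isOpen_ball (isOpen_Ioi (a := (0 : ℝ)))
    convert h2 using 2
    ext y
    simp
  have hWB : closure W ⊆ Metric.closedBall x r :=
    closure_minimal (inter_subset_left.trans Metric.ball_subset_closedBall)
      Metric.isClosed_closedBall
  have hclos : ∀ z ∈ closure W, cone z ≤ u z := by
    intro z hz
    have hcl := (huB.mono hWB).sub hcc.continuousOn
    have : ∀ w ∈ closure W, 0 ≤ u w - cone w := by
      intro w hw
      refine ContinuousWithinAt.closure_le (s := W) (f := fun _ => (0 : ℝ))
        (g := fun w => u w - cone w) hw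
        continuousWithinAt_const ((hcl w hw).mono subset_closure) ?_
      intro y hy
      have : cone y < u y := hy.2
      linarith
    linarith [this z hz]
  have hfr : ∀ z ∈ frontier W, cone z = u z := by
    intro z hz
    refine le_antisymm (hclos z hz.1) ?_
    have hzW : z ∉ W := by
      have := hz.2
      rwa [hWo.interior_eq] at this
    rcases (Metric.mem_closedBall.1 (hWB hz.1)).lt_or_eq with hlt | heq
    · by_contra! hcon
      exact hzW ⟨hlt, hcon⟩
    · exact hle z heq
  have hseg := h.sub_le W hWo ((isCompact_closedBall x r).of_isClosed_subset isClosed_closure hWB)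
    (hWB.trans hΩ) k hne cone (fun y z => by
      have := supportFun_sub_le hK hne (y - x') (z - x')
      rw [sub_sub_sub_cancel_right] at this
      simp only [hcone]
      linarith) hfr
  intro y hy
  by_contra! hcon
  have hyW : y ∈ W := ⟨hy, hcon⟩
  -- The vertex only has to lie outside `W`. On the way from `x'` to `y` there is a last point `γ t`
  -- outside `W`; from there on the slope bound holds, while at `γ t` the function `u` equals the
  -- cone, which is linear along the ray.
  have hx'W : x' ∉ W := fun hx => by
    have : cone x' < u x' := hx.2
    simp [hcone, hL, supportFun_zero hK hne] at this
  set γ : ℝ → F := fun t => x' + t • (y - x') with hγ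
  have hγc : Continuous γ := by fun_prop
  set T : Set ℝ := Icc 0 1 ∩ γ ⁻¹' Wᶜ with hT
  have hTc : IsCompact T := isCompact_Icc.inter_right (hWo.isClosed_compl.preimage hγc)
  have hT0 : (0 : ℝ) ∈ T := ⟨by simp, by simpa [hγ] using hx'W⟩
  obtain ⟨t, htT, htmax⟩ := hTc.exists_isGreatest ⟨0, hT0⟩
  have hγ1 : γ 1 = y := by simp [hγ]
  have ht1 : t < 1 := by
    refine lt_of_le_of_ne htT.1.2 ?_
    rintro rfl
    exact htT.2 (by rwa [hγ1])
  have hin : ∀ s ∈ Ioc t 1, γ s ∈ W := by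
    intro s hs
    by_contra hsW
    exact absurd (htmax ⟨⟨htT.1.1.trans hs.1.le, hs.2⟩, hsW⟩) (not_le.2 hs.1)
  have hle' : ∀ s ∈ Ioc t 1, u y - u (γ s) ≤ L (y - γ s) := by
    intro s hs
    refine hseg y (γ s) ?_
    intro w hw
    obtain ⟨a, b, ha, hb, hab, rfl⟩ := hw
    have hw' : a • γ s + b • y = γ (a * s + b) := by
      have : a = 1 - b := by linarith
      subst this
      simp only [hγ]
      module
    rw [hw']
    have hs1 : a * s ≤ a := mul_le_of_le_one_right ha hs.2
    refine hin _ ⟨?_, by linarith⟩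
    rcases hb.eq_or_lt with rfl | hb'
    · have : a = 1 := by linarith
      subst this
      simpa using hs.1
    · nlinarith [hs.1, hs.2]
  have htcl : γ t ∈ closure W := by
    have : t ∈ closure (Ioc t 1) := by
      rw [closure_Ioc ht1.ne]
      exact ⟨le_rfl, ht1.le⟩
    exact map_mem_closure hγc this hin
  have hzfr : γ t ∈ frontier W := ⟨htcl, by rw [hWo.interior_eq]; exact htT.2⟩
  have hlim : u y - u (γ t) ≤ L (y - γ t) := by
    have hmem : t ∈ closure (Ioc t 1) := by
      rw [closure_Ioc ht1.ne]
      exact ⟨le_rfl, ht1.le⟩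
    refine ContinuousWithinAt.closure_le (s := Ioc t 1) (f := fun s => u y - u (γ s))
      (g := fun s => L (y - γ s)) hmem ?_ ?_ hle'
    · refine continuousWithinAt_const.sub ?_
      exact ContinuousWithinAt.comp (t := closure W) (huB.mono hWB _ htcl)
        hγc.continuousWithinAt fun s hs => subset_closure (hin s hs)
    · exact (hLc.comp (continuous_const.sub hγc)).continuousWithinAt
  have h1 := hfr _ hzfr
  have h2 : γ t - x' = t • (y - x') := by simp [hγ]
  have h3 : y - γ t = (1 - t) • (y - x') := by simp only [hγ]; module
  rw [h3, hL, supportFun_smul hK hne (by linarith)] at hlim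
  simp only [hcone, h2] at h1 hcon
  rw [hL, supportFun_smul hK hne htT.1.1] at h1
  simp only [hL] at hcon
  nlinarith

/-- If `min H < κ`, the growth of `u` on small spheres around `x` is extremal. -/
lemma IsSlopeMinimizer.exists_mem_sphere [ProperSpace F] [Nontrivial F]
    (h : IsSlopeMinimizer H Ω u) (hK : ∀ k, IsCompact {p | H p ≤ k}) (hconv : ConvexOn ℝ univ H)
    {κ : ℝ} (hκ : IsGLB (slopeLevels H u x) κ) {p₀ : F} (hp₀ : H p₀ < κ) {r : ℝ} (hr : 0 < r)
    (hΩ : Metric.closedBall x r ⊆ Ω) :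
    ∃ y ∈ Metric.sphere x r, u x + supportFun {p | H p ≤ κ} (y - x) ≤ u y := by
  by_contra! hcon
  have hne : {p | H p ≤ κ}.Nonempty := ⟨p₀, hp₀.le⟩
  have hLc := continuous_supportFun (hK κ) hne
  have huB : ContinuousOn u (Metric.closedBall x r) := h.continuousOn.mono hΩ
  -- By compactness the strict inequality holds on the sphere with a uniform gap `η`; the rest
  -- spends at most `3η/4` of it.
  obtain ⟨y₀, hy₀, hmin⟩ := (isCompact_sphere x r).exists_isMinOn
    (NormedSpace.sphere_nonempty.2 hr.le)
    (f := fun y => u x + supportFun {p | H p ≤ κ} (y - x) - u y)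
    (ContinuousOn.sub (by fun_prop) (huB.mono Metric.sphere_subset_closedBall))
  set η := u x + supportFun {p | H p ≤ κ} (y₀ - x) - u y₀ with hη
  have hη0 : 0 < η := by have := hcon y₀ hy₀; linarith
  obtain ⟨C, hC0, hC⟩ := exists_supportFun_le_mul_norm (hK κ) hne
  set D := (C + ‖p₀‖) * r with hD
  have hD0 : 0 ≤ D := by positivity
  set s := min 1 (η / (4 * (D + 1))) with hs
  have hs0 : 0 < s := by positivity
  have hs1 : s ≤ 1 := min_le_left _ _
  have hsD : s * D ≤ η / 4 := by
    have h1 : s ≤ η / (4 * (D + 1)) := min_le_right _ _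
    rw [le_div_iff₀ (by positivity)] at h1
    nlinarith
  set k := (1 - s) * κ + s * H p₀ with hk
  have hkκ : k < κ := by nlinarith
  have hne' : {p | H p ≤ k}.Nonempty := ⟨p₀, by simp only [hk, mem_ofPred_eq]; nlinarith⟩
  have hcomp : ∀ q, ‖q‖ = r → supportFun {p | H p ≤ κ} q - s * D ≤ supportFun {p | H p ≤ k} q := by
    intro q hq
    obtain ⟨p, hp, hpq⟩ := exists_inner_eq_supportFun (hK κ) hne q
    have hmem : (1 - s) • p + s • p₀ ∈ {p | H p ≤ k} := by
      have h1 := hconv.2 (mem_univ p) (mem_univ p₀) (sub_nonneg.2 hs1) hs0.le (by ring)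
      simp only [smul_eq_mul] at h1
      have h2 : (1 - s) * H p ≤ (1 - s) * κ := mul_le_mul_of_nonneg_left hp (sub_nonneg.2 hs1)
      simp only [mem_ofPred_eq, hk]
      linarith
    have h1 := inner_le_supportFun (hK k) hmem q
    rw [inner_add_left, real_inner_smul_left, real_inner_smul_left, hpq] at h1
    have h2 := hC q
    have h3 := (abs_le.1 (abs_real_inner_le_norm p₀ q)).1
    rw [hq] at h2 h3
    have h4 : supportFun {p | H p ≤ κ} q - inner ℝ p₀ q ≤ D := by rw [hD]; linarith
    nlinarith
  obtain ⟨C', hC'0, hC'⟩ := exists_supportFun_le_mul_norm (hK k) hne'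
  have hux : ContinuousAt u x :=
    huB.continuousAt (Metric.closedBall_mem_nhds x hr)
  obtain ⟨δ₁, hδ₁, hδu⟩ := Metric.continuousAt_iff.1 hux (η / 4) (by positivity)
  -- Moving the vertex from `x` to `z` within distance `δ` costs `η / 4` through `u` and `η / 4`
  -- through `L_k (z - x)`, so the cone at `z` still dominates on the sphere.
  set δ := min (min δ₁ r) (η / (4 * C')) with hδ
  have hδ0 : 0 < δ := by positivity
  have hmem : k ∈ slopeLevels H u x := by
    refine ⟨hne', δ, hδ0, fun y hy z hz => ?_⟩
    have hyr : y ∈ Metric.ball x r :=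
      Metric.ball_subset_ball ((min_le_left _ _).trans (min_le_right _ _)) hy
    refine sub_le_iff_le_add'.2 (h.le_cone hΩ (hK k) hne' (fun w hw => ?_) y hyr)
    have h1 : η ≤ u x + supportFun {p | H p ≤ κ} (w - x) - u w := hmin hw
    have h2 := hcomp (w - x) (by rw [← dist_eq_norm]; exact hw)
    have h3 := hδu (lt_of_lt_of_le hz ((min_le_left _ _).trans (min_le_left _ _)))
    rw [Real.dist_eq, abs_lt] at h3
    have h4 := supportFun_sub_le (hK k) hne' (w - x) (w - z)
    rw [sub_sub_sub_cancel_left] at h4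
    have h5 := hC' (z - x)
    have h6 : ‖z - x‖ ≤ η / (4 * C') := by
      rw [← dist_eq_norm]
      exact (le_of_lt hz).trans (min_le_right _ _)
    rw [le_div_iff₀ (by positivity)] at h6
    linarith
  exact absurd (hκ.1 hmem) (not_le.2 hkκ)

end SlopeMinimizer

/-! ### Rescalings, extremal rays and linearity -/

section BlowUp

variable {F : Type*} [NormedAddCommGroup F] [InnerProductSpace ℝ F]

/-- Slope bounds are available only for levels above the infimum `κ`; compactness of maximizers
passes them to `κ` itself, and also shows that `{H ≤ κ}` is nonempty. -/
lemma exists_inner_ge_of_forall_lt {H : F → ℝ} (hc : Continuous H)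
    (hK : ∀ k, IsCompact {p | H p ≤ k}) {κ a : ℝ} {q : F}
    (h : ∀ k > κ, {p | H p ≤ k}.Nonempty ∧ a ≤ supportFun {p | H p ≤ k} q) :
    ∃ p, H p ≤ κ ∧ a ≤ inner ℝ p q := by
  have hk : ∀ j : ℕ, κ < κ + 1 / ((j : ℝ) + 1) := fun j => by
    have : 0 < 1 / ((j : ℝ) + 1) := by positivity
    linarith
  have hp : ∀ j : ℕ, ∃ p, H p ≤ κ + 1 / ((j : ℝ) + 1) ∧ a ≤ inner ℝ p q := by
    intro j
    obtain ⟨hne, ha⟩ := h _ (hk j)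
    obtain ⟨p, hp, hpe⟩ := exists_inner_eq_supportFun (hK _) hne q
    exact ⟨p, hp, hpe ▸ ha⟩
  choose p hp hpa using hp
  have hp1 : ∀ j, p j ∈ {p | H p ≤ κ + 1} := fun j => (hp j).trans (by
    have : 1 / ((j : ℝ) + 1) ≤ 1 := by
      rw [div_le_one (by positivity)]
      linarith [Nat.cast_nonneg (α := ℝ) j]
    linarith)
  obtain ⟨p', -, φ, hφ, hlim⟩ := (hK (κ + 1)).tendsto_subseq hp1
  refine ⟨p', ?_, ?_⟩
  · have h1 : Tendsto (fun j => κ + 1 / ((φ j : ℝ) + 1)) atTop (𝓝 (κ + 0)) :=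
      (tendsto_one_div_add_atTop_nhds_zero_nat.comp hφ.tendsto_atTop).const_add κ
    rw [add_zero] at h1
    exact le_of_tendsto_of_tendsto' ((hc.tendsto _).comp hlim) h1 fun j => hp (φ j)
  · have h2 : Continuous fun p : F => inner ℝ p q := by fun_prop
    exact ge_of_tendsto' ((h2.tendsto _).comp hlim) fun j => hpa (φ j)

omit [InnerProductSpace ℝ F] in
/-- A family of functions that are eventually `C`-Lipschitz on balls and converge pointwise
converges along convergent points. -/
lemma tendsto_apply_of_lipschitz {ι : Type*} {U : Filter ι} {w : ι → F → ℝ} {v : F → ℝ} {C : ℝ}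
    (hw : ∀ R : ℝ, ∀ᶠ j in U, ∀ y ∈ Metric.closedBall (0 : F) R, ∀ z ∈ Metric.closedBall (0 : F) R,
      |w j y - w j z| ≤ C * ‖y - z‖)
    (hv : ∀ y, Tendsto (fun j => w j y) U (𝓝 (v y))) {y : ι → F} {y₀ : F}
    (hy : Tendsto y U (𝓝 y₀)) : Tendsto (fun j => w j (y j)) U (𝓝 (v y₀)) := by
  have h1 : Tendsto (fun j => w j (y j) - w j y₀) U (𝓝 0) := by
    have h0 : Tendsto (fun j => C * ‖y j - y₀‖) U (𝓝 0) := by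
      have := ((hy.sub_const y₀).norm).const_mul C
      simpa using this
    refine squeeze_zero_norm' ?_ h0
    filter_upwards [hw (‖y₀‖ + 1), hy.eventually (Metric.ball_mem_nhds y₀ one_pos)] with j hj hyj
    refine hj _ ?_ _ ?_
    · rw [mem_closedBall_zero_iff]
      have h2 : ‖y j - y₀‖ < 1 := by rwa [← dist_eq_norm]
      have h3 := norm_add_le y₀ (y j - y₀)
      rw [add_sub_cancel] at h3
      linarith
    · rw [mem_closedBall_zero_iff]
      linarith
  simpa using h1.add (hv y₀)

/-- The difference quotients of `u` at `x` at scale `r`. -/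
def rescale (u : F → ℝ) (x : F) (r : ℝ) (y : F) : ℝ := (u (x + r • y) - u x) / r

/-- Support functions are positively 1-homogeneous, so the slope bound is invariant under rescaling,
while its domain of validity grows to the whole space. -/
lemma eventually_rescale_sub_le {K : Set F} (hK : IsCompact K) (hne : K.Nonempty) {u : F → ℝ}
    {x : F} {δ : ℝ} (hδ : 0 < δ)
    (hu : ∀ y ∈ Metric.ball x δ, ∀ z ∈ Metric.ball x δ, u y - u z ≤ supportFun K (y - z))
    (R : ℝ) : ∀ᶠ r in 𝓝[>] (0 : ℝ), ∀ y ∈ Metric.closedBall (0 : F) R,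
      ∀ z ∈ Metric.closedBall (0 : F) R,
        rescale u x r y - rescale u x r z ≤ supportFun K (y - z) := by
  have h1 : ∀ᶠ r in 𝓝[>] (0 : ℝ), r * R < δ := by
    have : Tendsto (fun r : ℝ => r * R) (𝓝[>] 0) (𝓝 0) := by
      have : Continuous fun r : ℝ => r * R := by fun_prop
      have h := this.tendsto 0
      rw [zero_mul] at h
      exact h.mono_left nhdsWithin_le_nhds
    exact this.eventually (gt_mem_nhds hδ)
  filter_upwards [h1, self_mem_nhdsWithin] with r hr hr0 y hy z hz
  have hr0 : 0 < r := hr0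
  have hmem : ∀ y ∈ Metric.closedBall (0 : F) R, x + r • y ∈ Metric.ball x δ := by
    intro y hy
    rw [mem_closedBall_zero_iff] at hy
    rw [Metric.mem_ball, dist_self_add_left, norm_smul, Real.norm_of_nonneg hr0.le]
    exact (mul_le_mul_of_nonneg_left hy hr0.le).trans_lt hr
  have h := hu _ (hmem y hy) _ (hmem z hz)
  rw [add_sub_add_left_eq_sub, ← smul_sub, supportFun_smul hK hne hr0.le] at h
  rw [rescale, rescale, ← sub_div, div_le_iff₀ hr0]
  linarith

/-- A function with extremal growth on all spheres grows linearly along a ray. -/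
lemma exists_ray [ProperSpace F] {K : Set F} (hK : IsCompact K)
    (hne : K.Nonempty) {v : F → ℝ} (hv : ∀ y z, v y - v z ≤ supportFun K (y - z))
    (hs : ∀ R > 0, ∃ y, ‖y‖ = R ∧ supportFun K y ≤ v y) :
    ∃ a, ‖a‖ = 1 ∧ ∀ t : ℝ, 0 ≤ t → t * supportFun K a ≤ v (t • a) := by
  have hLc := continuous_supportFun hK hne
  have hvc : Continuous v := by
    obtain ⟨C, hC⟩ := exists_lipschitzWith_of_sub_le hK hne
    exact (lipschitzOnWith_univ.1 (hC v univ fun y _ z _ => hv y z)).continuous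
  have hN : ∀ N : ℕ, ∃ a, ‖a‖ = 1 ∧
      ∀ t : ℝ, 0 ≤ t → t ≤ N → t * supportFun K a ≤ v (t • a) := by
    intro N
    have hN0 : (0 : ℝ) < (N : ℝ) + 1 := by positivity
    obtain ⟨y, hyR, hy⟩ := hs (N + 1) hN0
    have hya : y = ((N : ℝ) + 1) • (((N : ℝ) + 1)⁻¹ • y) := by
      rw [smul_smul, mul_inv_cancel₀ hN0.ne', one_smul]
    refine ⟨((N : ℝ) + 1)⁻¹ • y, ?_, fun t ht htN => ?_⟩
    · rw [norm_smul, hyR, norm_inv, Real.norm_of_nonneg hN0.le, inv_mul_cancel₀ hN0.ne']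
    -- Extremal growth at the far point `y` propagates back towards the origin: `v (t • a) ≥ v y - L
    -- (y - t • a) ≥ t * L a`.
    · set a := ((N : ℝ) + 1)⁻¹ • y
      have h1 := hv y (t • a)
      have h2 : y - t • a = ((N : ℝ) + 1 - t) • a := by rw [sub_smul, ← hya]
      rw [h2, supportFun_smul hK hne (by linarith)] at h1
      have h3 : supportFun K y = ((N : ℝ) + 1) * supportFun K a := by
        conv_lhs => rw [hya]
        exact supportFun_smul hK hne hN0.le _
      rw [h3] at hy
      linarith
  choose a ha1 ha using hN
  obtain ⟨a', ha', φ, hφ, hlim⟩ := (isCompact_sphere (0 : F) 1).tendsto_subseq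
    (fun N => mem_sphere_zero_iff_norm.2 (ha1 N))
  refine ⟨a', mem_sphere_zero_iff_norm.1 ha', fun t ht => ?_⟩
  refine le_of_tendsto_of_tendsto (((hLc.tendsto _).comp hlim).const_mul t)
    (((hvc.comp (continuous_const_smul t)).tendsto _).comp hlim) ?_
  obtain ⟨N, hN⟩ := exists_nat_ge t
  filter_upwards [eventually_ge_atTop N] with j hj
  refine ha (φ j) t ht (hN.trans ?_)
  exact_mod_cast hj.trans (hφ.id_le j)

/-- With `p_N` maximizing the pairing with `N a - y`, the ray gives `v y ≥ v (N a) - L (N a - y) ≥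
p_N · y`. As `N → ∞`, the `p_N` accumulate at a maximizer for `a`, which can only be `e`. -/
lemma inner_le_of_ray {K : Set F} (hK : IsCompact K) (hne : K.Nonempty) {v : F → ℝ}
    (hv : ∀ y z, v y - v z ≤ supportFun K (y - z)) {a e : F}
    (ha : ∀ t : ℝ, 0 ≤ t → t * supportFun K a ≤ v (t • a)) (heK : e ∈ K)
    (he : ∀ p ∈ K, inner ℝ p a = supportFun K a → p = e) (y : F) : inner ℝ e y ≤ v y := by
  have hp : ∀ N : ℕ, ∃ p ∈ K, inner ℝ p y ≤ v y ∧
      (N : ℝ) * inner ℝ e a - inner ℝ e y ≤ N * inner ℝ p a - inner ℝ p y := by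
    intro N
    obtain ⟨p, hp, hpe⟩ := exists_inner_eq_supportFun hK hne ((N : ℝ) • a - y)
    refine ⟨p, hp, ?_, ?_⟩
    · have h1 := hv ((N : ℝ) • a) y
      have h2 := ha N (Nat.cast_nonneg N)
      have h3 := mul_le_mul_of_nonneg_left (inner_le_supportFun hK hp a) (Nat.cast_nonneg (α := ℝ) N)
      rw [← hpe, inner_sub_right, inner_smul_right] at h1
      linarith
    · have h1 := inner_le_supportFun hK heK ((N : ℝ) • a - y)
      rwa [← hpe, inner_sub_right, inner_smul_right, inner_sub_right, inner_smul_right] at h1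
  choose p hpK hpv hpe using hp
  obtain ⟨p', hp', φ, hφ, hlim⟩ := hK.tendsto_subseq hpK
  have hca : Continuous fun p : F => inner ℝ p a := by fun_prop
  have hcy : Continuous fun p : F => inner ℝ p y := by fun_prop
  have hla : Tendsto (fun j => inner ℝ (p (φ j)) a) atTop (𝓝 (inner ℝ p' a)) :=
    (hca.tendsto _).comp hlim
  have hly : Tendsto (fun j => inner ℝ (p (φ j)) y) atTop (𝓝 (inner ℝ p' y)) :=
    (hcy.tendsto _).comp hlim
  have hφ' : Tendsto (fun j => ((φ j : ℕ) : ℝ)) atTop atTop :=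
    tendsto_natCast_atTop_atTop.comp hφ.tendsto_atTop
  have key : inner ℝ e a ≤ inner ℝ p' a := by
    have h0 : Tendsto (fun j => inner ℝ (p (φ j)) a -
        (inner ℝ (p (φ j)) y - inner ℝ e y) / (φ j : ℝ)) atTop (𝓝 (inner ℝ p' a - 0)) :=
      hla.sub ((hly.sub_const _).div_atTop hφ')
    rw [sub_zero] at h0
    refine ge_of_tendsto h0 ?_
    filter_upwards [hφ'.eventually_gt_atTop 0] with j hj
    rw [le_sub_iff_add_le, ← le_sub_iff_add_le', div_le_iff₀ hj]
    linarith [hpe (φ j)]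
  have hpe' : p' = e := by
    obtain ⟨q, hq, hqa⟩ := exists_inner_eq_supportFun hK hne a
    have hqe := he q hq hqa
    subst hqe
    exact he p' hp' (le_antisymm (inner_le_supportFun hK hp' a) (hqa ▸ key))
  exact hpe' ▸ le_of_tendsto' hly fun j => hpv (φ j)

/-- A function with extremal growth in both directions is linear. -/
lemma exists_eq_inner_of_rays {H : F → ℝ} (hc : Continuous H) (hconv : ConvexOn ℝ univ H)
    (hA : ∀ c : ℝ, ∀ a b : F, a ≠ b → ¬ segment ℝ a b ⊆ H ⁻¹' {c}) {κ : ℝ}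
    (hK : IsCompact {p | H p ≤ κ}) (hne : {p | H p ≤ κ}.Nonempty) {v : F → ℝ}
    (hv : ∀ y z, v y - v z ≤ supportFun {p | H p ≤ κ} (y - z)) {a b : F} (ha0 : a ≠ 0)
    (hb0 : b ≠ 0) (ha : ∀ t : ℝ, 0 ≤ t → t * supportFun {p | H p ≤ κ} a ≤ v (t • a))
    (hb : ∀ t : ℝ, 0 ≤ t → t * supportFun {p | H p ≤ κ} b ≤ -v (-(t • b))) :
    ∃ e, H e = κ ∧ ∀ y, v y = inner ℝ e y := by
  -- The chain `L a + L b ≤ v a - v (-b) ≤ L (a + b) = e · a + e · b ≤ L a + L b` collapses, so `e`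
  -- is maximal for `a` and for `b` at once.
  obtain ⟨e, he, heab⟩ := exists_inner_eq_supportFun hK hne (a + b)
  have h1 := hv a (-b)
  rw [sub_neg_eq_add, ← heab, inner_add_right] at h1
  have h2 := ha 1 zero_le_one
  have h3 := hb 1 zero_le_one
  rw [one_smul, one_mul] at h2 h3
  have h4 := inner_le_supportFun hK he a
  have h5 := inner_le_supportFun hK he b
  obtain ⟨hHe, hea⟩ := eq_of_inner_eq_supportFun hc hconv hA hK ha0 he (by linarith)
  obtain ⟨-, heb⟩ := eq_of_inner_eq_supportFun hc hconv hA hK hb0 he (by linarith)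
  refine ⟨e, hHe, fun y => le_antisymm ?_ (inner_le_of_ray hK hne hv ha he hea y)⟩
  have := inner_le_of_ray hK hne (v := fun y => -v (-y)) (fun y z => by
    have := hv (-z) (-y)
    rw [neg_sub_neg] at this
    linarith) hb he heb (-y)
  rw [inner_neg_right, neg_neg] at this
  linarith

/-- Extremal points of `u` on spheres of radius `r j * R` rescale to the fixed sphere of radius `R`;
their limit is extremal for `v` because the rescalings are equi-Lipschitz. -/
lemma exists_sphere_limit [ProperSpace F] {K : Set F} (hK : IsCompact K) (hne : K.Nonempty)
    {U : Ultrafilter ℕ} {u v : F → ℝ} {x : F} {r : ℕ → ℝ} {C : ℝ}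
    (hr : Tendsto r U (𝓝[>] 0))
    (hw : ∀ R : ℝ, ∀ᶠ j in (U : Filter ℕ), ∀ y ∈ Metric.closedBall (0 : F) R,
      ∀ z ∈ Metric.closedBall (0 : F) R,
        |rescale u x (r j) y - rescale u x (r j) z| ≤ C * ‖y - z‖)
    (hv : ∀ y, Tendsto (fun j => rescale u x (r j) y) U (𝓝 (v y)))
    (hs : ∀ᶠ ρ in 𝓝[>] (0 : ℝ), ∃ y ∈ Metric.sphere x ρ, u x + supportFun K (y - x) ≤ u y) :
    ∀ R > 0, ∃ y, ‖y‖ = R ∧ supportFun K y ≤ v y := by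
  intro R hR
  have hrR : Tendsto (fun j => r j * R) U (𝓝[>] 0) := by
    refine tendsto_nhdsWithin_iff.2 ⟨?_, ?_⟩
    · have := (tendsto_nhdsWithin_iff.1 hr).1.mul_const R
      rwa [zero_mul] at this
    · filter_upwards [(tendsto_nhdsWithin_iff.1 hr).2] with j hj
      exact mul_pos hj hR
  have hz : ∀ᶠ j in (U : Filter ℕ), ∃ z ∈ Metric.sphere (0 : F) R,
      supportFun K z ≤ rescale u x (r j) z := by
    filter_upwards [hrR.eventually hs, (tendsto_nhdsWithin_iff.1 hr).2] with j hj hj0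
    have hj0 : 0 < r j := hj0
    obtain ⟨y, hy, hyu⟩ := hj
    have hyz : y - x = r j • ((r j)⁻¹ • (y - x)) := by
      rw [smul_smul, mul_inv_cancel₀ hj0.ne', one_smul]
    refine ⟨(r j)⁻¹ • (y - x), ?_, ?_⟩
    · rw [mem_sphere_zero_iff_norm, norm_smul, norm_inv, Real.norm_of_nonneg hj0.le,
        ← dist_eq_norm, Metric.mem_sphere.1 hy, inv_mul_cancel_left₀ hj0.ne']
    · rw [rescale, ← hyz, add_sub_cancel, le_div_iff₀ hj0]
      rw [hyz, supportFun_smul hK hne hj0.le] at hyu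
      linarith
  obtain ⟨z, hz⟩ := hz.choice
  obtain ⟨z', hz', hlim⟩ := (isCompact_sphere (0 : F) R).ultrafilter_le_nhds (U.map z)
    (le_principal_iff.2 (hz.mono fun j hj => hj.1))
  have hlim' : Tendsto z U (𝓝 z') := hlim
  exact ⟨z', mem_sphere_zero_iff_norm.1 hz',
    le_of_tendsto_of_tendsto (((continuous_supportFun hK hne).tendsto _).comp hlim')
      (tendsto_apply_of_lipschitz hw hv hlim') (hz.mono fun j hj => hj.2)⟩

end BlowUp

/-! ### Linearity of blow-up limits and compactness -/

section BlowUpLimit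

variable {F : Type*} [NormedAddCommGroup F] [InnerProductSpace ℝ F]

lemma rescale_zero (u : F → ℝ) (x : F) (r : ℝ) : rescale u x r 0 = 0 := by simp [rescale]

lemma rescale_neg (u : F → ℝ) (x : F) (r : ℝ) (y : F) :
    rescale (fun y => -u y) x r y = -rescale u x r y := by
  simp only [rescale]
  ring

omit [InnerProductSpace ℝ F] in
lemma eventually_closedBall_subset {Ω : Set F} (hΩ : IsOpen Ω) {x : F} (hx : x ∈ Ω) :
    ∀ᶠ ρ in 𝓝[>] (0 : ℝ), Metric.closedBall x ρ ⊆ Ω := by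
  obtain ⟨δ, hδ, h⟩ := Metric.isOpen_iff.1 hΩ x hx
  filter_upwards [Ioo_mem_nhdsGT hδ] with ρ hρ
  exact (Metric.closedBall_subset_ball hρ.2).trans h

variable [ProperSpace F] [Nontrivial F] {H : F → ℝ} {Ω : Set F} {u : F → ℝ} {x : F}

/-- Pointwise blow-up limits of `u` are linear, with slope on the level set of `H` at the infimum
of the slope levels. -/
lemma IsSlopeMinimizer.exists_limit_eq_inner (h : IsSlopeMinimizer H Ω u) (hc : Continuous H)
    (hconv : ConvexOn ℝ univ H) (hK : ∀ k, IsCompact {p | H p ≤ k})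
    (hA : ∀ c : ℝ, ∀ a b : F, a ≠ b → ¬ segment ℝ a b ⊆ H ⁻¹' {c})
    (hΩ : IsOpen Ω) (hx : x ∈ Ω) {κ : ℝ} (hκ : IsGLB (slopeLevels H u x) κ)
    {U : Ultrafilter ℕ} {r : ℕ → ℝ} (hr : Tendsto r U (𝓝[>] 0)) :
    ∃ e, H e = κ ∧ (∀ y, Tendsto (fun j => rescale u x (r j) y) U (𝓝 (inner ℝ e y))) ∧
      ∃ C, ∀ R : ℝ, ∀ᶠ j in (U : Filter ℕ), ∀ y ∈ Metric.closedBall (0 : F) R,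
        ∀ z ∈ Metric.closedBall (0 : F) R,
          |rescale u x (r j) y - rescale u x (r j) z| ≤ C * ‖y - z‖ := by
  have hlip : ∀ k > κ, ∀ R : ℝ, ∀ᶠ j in (U : Filter ℕ), ∀ y ∈ Metric.closedBall (0 : F) R,
      ∀ z ∈ Metric.closedBall (0 : F) R,
        rescale u x (r j) y - rescale u x (r j) z ≤ supportFun {p | H p ≤ k} (y - z) := by
    intro k hk R
    obtain ⟨hne, δ, hδ, hu⟩ := mem_slopeLevels_of_isGLB hK hκ hk
    exact hr.eventually (eventually_rescale_sub_le (hK k) hne hδ hu R)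
  have hne' : ∀ k > κ, {p | H p ≤ k}.Nonempty := fun k hk =>
    (mem_slopeLevels_of_isGLB hK hκ hk).1
  obtain ⟨C, hC0, hC⟩ := exists_supportFun_le_mul_norm (hK (κ + 1)) (hne' _ (lt_add_one κ))
  have hw : ∀ R : ℝ, ∀ᶠ j in (U : Filter ℕ), ∀ y ∈ Metric.closedBall (0 : F) R,
      ∀ z ∈ Metric.closedBall (0 : F) R,
        |rescale u x (r j) y - rescale u x (r j) z| ≤ C * ‖y - z‖ := by
    intro R
    filter_upwards [hlip (κ + 1) (lt_add_one κ) R] with j hj y hy z hz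
    exact abs_sub_le_of_sub_le hC (hj y hy z hz) (hj z hz y hy)
  have hlim : ∀ y, ∃ l, Tendsto (fun j => rescale u x (r j) y) U (𝓝 l) := by
    intro y
    obtain ⟨l, -, hl⟩ := (isCompact_closedBall (0 : ℝ) (C * ‖y‖)).ultrafilter_le_nhds
      (U.map fun j => rescale u x (r j) y) (le_principal_iff.2 (by
        change ∀ᶠ j in (U : Filter ℕ), rescale u x (r j) y ∈ Metric.closedBall (0 : ℝ) (C * ‖y‖)
        filter_upwards [hw ‖y‖] with j hj
        have := hj y (by simp) 0 (by simp)
        rw [rescale_zero, sub_zero, sub_zero] at this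
        simpa using this))
    exact ⟨l, hl⟩
  choose v hv using hlim
  have hv0 : v 0 = 0 :=
    tendsto_nhds_unique (hv 0) (by simp only [rescale_zero]; exact tendsto_const_nhds)
  have hex : ∀ y z, ∃ p, H p ≤ κ ∧ v y - v z ≤ inner ℝ p (y - z) := by
    intro y z
    refine exists_inner_ge_of_forall_lt hc hK fun k hk => ⟨hne' k hk, ?_⟩
    refine le_of_tendsto ((hv y).sub (hv z)) ?_
    filter_upwards [hlip k hk (max ‖y‖ ‖z‖)] with j hj
    exact hj y (by simp) z (by simp)
  have hne : {p | H p ≤ κ}.Nonempty := by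
    obtain ⟨p, hp, -⟩ := hex 0 0
    exact ⟨p, hp⟩
  have hvL : ∀ y z, v y - v z ≤ supportFun {p | H p ≤ κ} (y - z) := by
    intro y z
    obtain ⟨p, hp, h⟩ := hex y z
    exact h.trans (inner_le_supportFun (hK κ) hp _)
  suffices ∃ e, H e = κ ∧ ∀ y, v y = inner ℝ e y by
    obtain ⟨e, he, hev⟩ := this
    exact ⟨e, he, fun y => hev y ▸ hv y, C, hw⟩
  by_cases hmin : ∃ p₀, H p₀ < κ
  · obtain ⟨p₀, hp₀⟩ := hmin
    have hball := eventually_closedBall_subset hΩ hx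
    obtain ⟨a, ha1, ha⟩ := exists_ray (hK κ) hne hvL
      (exists_sphere_limit (hK κ) hne hr hw hv (by
        filter_upwards [hball, self_mem_nhdsWithin] with ρ hρ hρ0
        exact h.exists_mem_sphere hK hconv hκ hp₀ hρ0 hρ))
    have hKn : ∀ k, IsCompact {p | H (-p) ≤ k} := fun k =>
      (hK k).neg
    have hnen := nonempty_sublevel_neg.2 hne
    have hconvn : ConvexOn ℝ univ fun p => H (-p) :=
      hconv.comp_linearMap (-LinearMap.id : F →ₗ[ℝ] F)
    obtain ⟨b, hb1, hb⟩ := exists_ray (v := fun y => -v y) (hKn κ) hnen (fun y z => by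
        rw [supportFun_setOf_neg_le, neg_sub]
        have := hvL z y
        linarith)
      (exists_sphere_limit (u := fun y => -u y) (x := x) (C := C) (hKn κ) hnen hr
        (fun R => by
          filter_upwards [hw R] with j hj y hy z hz
          rw [rescale_neg, rescale_neg, neg_sub_neg, abs_sub_comm]
          exact hj y hy z hz)
        (fun y => by simp only [rescale_neg]; exact (hv y).neg)
        (by
          filter_upwards [hball, self_mem_nhdsWithin] with ρ hρ hρ0
          exact h.neg.exists_mem_sphere hKn hconvn (by rwa [slopeLevels_neg])
            (p₀ := -p₀) (by simpa using hp₀) hρ0 hρ))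
    refine exists_eq_inner_of_rays hc hconv hA (hK κ) hne hvL (a := a) (b := -b) ?_ ?_ ha ?_
    · exact norm_ne_zero_iff.1 (by rw [ha1]; exact one_ne_zero)
    · exact neg_ne_zero.2 (norm_ne_zero_iff.1 (by rw [hb1]; exact one_ne_zero))
    · intro t ht
      have := hb t ht
      rwa [supportFun_setOf_neg_le, ← neg_neg (t • b), ← smul_neg] at this
  -- Here `κ` is the minimum of `H`, so the convex set `{H ≤ κ}` lies in one level set and (A)
  -- reduces it to a point.
  · push Not at hmin
    obtain ⟨e, he⟩ := hne
    have hconvK : Convex ℝ {p | H p ≤ κ} := by simpa using hconv.convex_le κ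
    have huniq : ∀ p ∈ {p | H p ≤ κ}, p = e := by
      intro p hp
      by_contra hpe
      exact hA κ p e hpe fun q hq =>
        le_antisymm (hconvK.segment_subset hp he hq) (hmin q)
    have hvle : ∀ y z, v y - v z ≤ inner ℝ e (y - z) := by
      intro y z
      obtain ⟨p, hp, h⟩ := hex y z
      rwa [huniq p hp] at h
    refine ⟨e, le_antisymm he (hmin e), fun y => le_antisymm ?_ ?_⟩
    · simpa [hv0] using hvle y 0
    · simpa [hv0] using hvle 0 y

/-- Every sequence of scales has a subsequence along which `u` is uniformly approximated by a
linear function with slope on a prescribed level set of `H`. -/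
theorem IsSlopeMinimizer.exists_subseq_tendsto (h : IsSlopeMinimizer H Ω u) (hc : Continuous H)
    (hconv : ConvexOn ℝ univ H) (hK : ∀ k, IsCompact {p | H p ≤ k})
    (hA : ∀ c : ℝ, ∀ a b : F, a ≠ b → ¬ segment ℝ a b ⊆ H ⁻¹' {c})
    (hΩ : IsOpen Ω) (hx : x ∈ Ω) {κ : ℝ} (hκ : IsGLB (slopeLevels H u x) κ)
    {r : ℕ → ℝ} (hr : Tendsto r atTop (𝓝[>] 0)) :
    ∃ φ : ℕ → ℕ, StrictMono φ ∧ ∃ e, H e = κ ∧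
      Tendsto (fun k => ⨆ y ∈ Metric.ball (0 : F) 1,
        ENNReal.ofReal |(u (x + r (φ k) • y) - u x) / r (φ k) - inner ℝ e y|) atTop (𝓝 0) := by
  -- An ultrafilter provides the limits at all points `y` simultaneously, in place of a diagonal
  -- argument.
  set U : Ultrafilter ℕ := Ultrafilter.of atTop
  have hU : (U : Filter ℕ) ≤ atTop := Ultrafilter.of_le atTop
  obtain ⟨e, he, hlim, C, hw⟩ :=
    h.exists_limit_eq_inner hc hconv hK hA hΩ hx hκ (hr.mono_left hU)
  set S : ℕ → ℝ≥0∞ := fun k => ⨆ y ∈ Metric.ball (0 : F) 1,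
    ENNReal.ofReal |rescale u x (r k) y - inner ℝ e y| with hS
  have hSlim : Tendsto S U (𝓝 0) := by
    refine ENNReal.tendsto_nhds_zero.2 fun ε hε => ?_
    by_contra hcon
    rw [← Ultrafilter.eventually_not] at hcon
    have hex : ∀ᶠ j in (U : Filter ℕ), ∃ y, y ∈ Metric.closedBall (0 : F) 1 ∧
        ε ≤ ENNReal.ofReal |rescale u x (r j) y - inner ℝ e y| := by
      filter_upwards [hcon] with j hj
      by_contra! hcon'
      exact hj (iSup₂_le fun y hy => (hcon' y (Metric.ball_subset_closedBall hy)).le)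
    obtain ⟨y, hy⟩ := hex.choice
    obtain ⟨y', -, hy'⟩ := (isCompact_closedBall (0 : F) 1).ultrafilter_le_nhds (U.map y)
      (le_principal_iff.2 (hy.mono fun j hj => hj.1))
    have hyl : Tendsto y U (𝓝 y') := hy'
    have h1 := tendsto_apply_of_lipschitz hw hlim hyl
    have h2 : Continuous fun y : F => (inner ℝ e y : ℝ) := by fun_prop
    have h3 := ENNReal.tendsto_ofReal (h1.sub ((h2.tendsto _).comp hyl)).abs
    rw [sub_self, abs_zero, ENNReal.ofReal_zero] at h3
    exact absurd (ge_of_tendsto h3 (hy.mono fun j hj => hj.2)) (not_le.2 hε)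
  -- Convergence along a finer filter makes `0` a cluster point, from which a genuine subsequence is
  -- extracted.
  have hcl : MapClusterPt 0 atTop S :=
    (hSlim.mapClusterPt).mono hU
  obtain ⟨φ, hφ, hφS⟩ := hcl.tendsto_subseq
  exact ⟨φ, hφ, e, he, hφS⟩

end BlowUpLimit

/-! ### Weak gradients and the supremal functional -/

section WeakGradient

variable {n : ℕ} {u v : E n → ℝ} {G : E n → E n} {V W : Set (E n)}

lemma integrable_mul_of_tsupport_subset {f g : E n → ℝ} (hf : LocallyIntegrableOn f V volume)
    (hg : Continuous g) (hgc : HasCompactSupport g) (hgV : tsupport g ⊆ V) :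
    Integrable (fun x => f x * g x) volume := by
  have h1 : IntegrableOn f (tsupport g) volume := hf.integrableOn_compact_subset hgV hgc
  have h2 := h1.mul_continuousOn hg.continuousOn hgc
  refine (integrableOn_iff_integrable_of_support_subset ?_).1 h2
  intro x hx
  exact subset_tsupport g (right_ne_zero_of_mul hx)

lemma setIntegral_mul_of_tsupport_subset {f g : E n → ℝ} (hgV : tsupport g ⊆ V) :
    ∫ x in V, f x * g x = ∫ x, f x * g x :=
  setIntegral_eq_integral_of_forall_compl_eq_zero fun x hx => by
    rw [image_eq_zero_of_notMem_tsupport fun h => hx (hgV h), mul_zero]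

lemma locallyIntegrableOn_inner_const (hG : LocallyIntegrableOn G V volume) (q : E n) :
    LocallyIntegrableOn (fun x => inner ℝ (G x) q) V volume := fun x hx =>
  let ⟨s, hs, h⟩ := hG x hx
  ⟨s, hs, h.inner_const q⟩

lemma locallyIntegrableOn_coord (hG : LocallyIntegrableOn G V volume) (i : Fin n) :
    LocallyIntegrableOn (fun x => G x i) V volume := by
  have := locallyIntegrableOn_inner_const hG (EuclideanSpace.single i 1)
  simpa [EuclideanSpace.inner_single_right] using this

lemma tsupport_fderiv_apply_const_subset (φ : E n → ℝ) (q : E n) :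
    tsupport (fun x => fderiv ℝ φ x q) ⊆ tsupport φ :=
  (closure_mono fun x hx => by
    intro h
    exact hx (by simp [h])).trans (tsupport_fderiv_subset ℝ)

lemma HasWeakGradient.integral_mul_fderiv (h : HasWeakGradient v G V) {φ : E n → ℝ}
    (hφ : ContDiff ℝ ∞ φ) (hφc : HasCompactSupport φ) (hφV : tsupport φ ⊆ V) (q : E n) :
    ∫ x, v x * fderiv ℝ φ x q = -∫ x, inner ℝ (G x) q * φ x := by
  have hsub : ∀ q, tsupport (fun x => fderiv ℝ φ x q) ⊆ V :=
    fun q => (tsupport_fderiv_apply_const_subset φ q).trans hφV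
  have hcomp : ∀ q, HasCompactSupport (fun x => fderiv ℝ φ x q) :=
    fun q => hφc.of_isClosed_subset (isClosed_tsupport _) (tsupport_fderiv_apply_const_subset φ q)
  have hcont : ∀ q, Continuous (fun x => fderiv ℝ φ x q) :=
    fun q => (hφ.continuous_fderiv (by simp)).clm_apply continuous_const
  have hi : ∀ i : Fin n, ∫ x, v x * fderiv ℝ φ x (EuclideanSpace.single i 1)
      = -∫ x, G x i * φ x := by
    intro i
    have := h.2.2 φ hφ hφc hφV i
    rwa [setIntegral_mul_of_tsupport_subset (hsub _),
      setIntegral_mul_of_tsupport_subset hφV] at this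
  have hq : q = ∑ i, q i • (EuclideanSpace.single i (1 : ℝ) : E n) := by
    ext j
    simp [Finset.sum_apply, Pi.single_apply]
  have h1 : ∀ x, v x * fderiv ℝ φ x q =
      ∑ i, q i * (v x * fderiv ℝ φ x (EuclideanSpace.single i 1)) := by
    intro x
    conv_lhs => rw [hq, map_sum, Finset.mul_sum]
    refine Finset.sum_congr rfl fun i _ => ?_
    rw [map_smul, smul_eq_mul]
    ring
  have h2 : ∀ x, inner ℝ (G x) q * φ x = ∑ i, q i * (G x i * φ x) := by
    intro x
    rw [PiLp.inner_apply, Finset.sum_mul]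
    refine Finset.sum_congr rfl fun i _ => ?_
    simp only [RCLike.inner_apply, conj_trivial]
    ring
  simp_rw [h1, h2]
  rw [integral_finsetSum _ fun i _ => (integrable_mul_of_tsupport_subset h.1 (hcont _) (hcomp _)
      (hsub _)).const_mul _,
    integral_finsetSum _ fun i _ => (integrable_mul_of_tsupport_subset
      (locallyIntegrableOn_coord h.2.1 i) hφ.continuous hφc hφV).const_mul _,
    ← Finset.sum_neg_distrib]
  refine Finset.sum_congr rfl fun i _ => ?_
  rw [integral_const_mul, integral_const_mul, hi, mul_neg]

lemma HasWeakGradient.mono (h : HasWeakGradient v G V) (hWV : W ⊆ V) : HasWeakGradient v G W := by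
  refine ⟨h.1.mono_set hWV, h.2.1.mono_set hWV, fun φ hφ hφc hφW i => ?_⟩
  have := h.2.2 φ hφ hφc (hφW.trans hWV) i
  have hsub := (tsupport_fderiv_apply_const_subset φ (EuclideanSpace.single i 1)).trans hφW
  rw [setIntegral_mul_of_tsupport_subset (hsub.trans hWV),
    setIntegral_mul_of_tsupport_subset (hφW.trans hWV)] at this
  rw [setIntegral_mul_of_tsupport_subset hsub, setIntegral_mul_of_tsupport_subset hφW, this]

lemma HasWeakGradient.congr (h : HasWeakGradient v G V) (hV : MeasurableSet V)
    (huv : EqOn u v V) : HasWeakGradient u G V := by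
  refine ⟨fun x hx => ?_, h.2.1, fun φ hφ hφc hφV i => ?_⟩
  · obtain ⟨s, hs, hsi⟩ := h.1 x hx
    refine ⟨s ∩ V, inter_mem hs self_mem_nhdsWithin, ?_⟩
    have h1 : IntegrableOn v (s ∩ V) volume := hsi.mono_set inter_subset_left
    have h2 : Integrable u ((volume.restrict s).restrict V) := by
      have h3 : Integrable v ((volume.restrict s).restrict V) :=
        Integrable.restrict (show Integrable v (volume.restrict s) from hsi)
      exact h3.congr ((ae_restrict_iff' hV).2 (.of_forall fun x hx => (huv hx).symm))
    rwa [Measure.restrict_restrict hV, inter_comm] at h2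
  · rw [← h.2.2 φ hφ hφc hφV i]
    exact setIntegral_congr_fun hV fun x hx => by simp only [huv hx]

lemma HasWeakGradient.ae_eq {G' : E n → E n} (hV : IsOpen V) (h : HasWeakGradient v G V)
    (h' : HasWeakGradient v G' V) : G =ᵐ[volume.restrict V] G' := by
  have hi : ∀ i : Fin n, ∀ᵐ x, x ∈ V → G x i - G' x i = 0 := by
    intro i
    have hl := locallyIntegrableOn_coord h.2.1 i
    have hl' := locallyIntegrableOn_coord h'.2.1 i
    refine hV.ae_eq_zero_of_integral_contDiff_smul_eq_zero (hl.sub hl') fun g hg hgc hgV => ?_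
    have h1 := h.2.2 g hg hgc hgV i
    rw [h'.2.2 g hg hgc hgV i, setIntegral_mul_of_tsupport_subset hgV,
      setIntegral_mul_of_tsupport_subset hgV] at h1
    have h2 : ∀ x, g x • (G x i - G' x i) = G x i * g x - G' x i * g x := fun x => by
      rw [smul_eq_mul]
      ring
    simp_rw [h2]
    rw [integral_sub (integrable_mul_of_tsupport_subset hl hg.continuous hgc hgV)
      (integrable_mul_of_tsupport_subset hl' hg.continuous hgc hgV)]
    linarith
  refine (ae_restrict_iff' hV.measurableSet).2 ?_
  filter_upwards [ae_all_iff.2 hi] with x hx hxV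
  ext i
  exact sub_eq_zero.1 (hx i hxV)

lemma HasWeakGradient.weakGrad (h : HasWeakGradient v G V) :
    HasWeakGradient v (weakGrad v V) V := by
  have hex : ∃ G : E n → E n, HasWeakGradient v G V := ⟨G, h⟩
  rw [AbsMin.weakGrad, dif_pos hex]
  exact hex.choose_spec

/-- By almost everywhere uniqueness any weak gradient may replace the chosen one; in particular one
`G` on `Ω` serves for all its open subsets. -/
lemma HasWeakGradient.supFunctional_le_iff (hV : IsOpen V) (h : HasWeakGradient v G V)
    (H : E n → ℝ) (k : ℝ) :
    supFunctional H v V ≤ k ↔ ∀ᵐ x ∂volume.restrict V, H (G x) ≤ k := by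
  have hG := h.ae_eq hV h.weakGrad
  constructor
  · intro hk
    have h1 : ∀ᵐ x ∂volume.restrict V, ((H (AbsMin.weakGrad v V x) : ℝ) : EReal) ≤
        supFunctional H v V := ae_le_essSup
    filter_upwards [h1, hG] with x hx hGx
    rw [hGx]
    exact EReal.coe_le_coe_iff.1 (hx.trans hk)
  · intro hk
    refine essSup_le_of_ae_le _ ?_
    filter_upwards [hk, hG] with x hx hGx
    rw [← hGx]
    exact EReal.coe_le_coe_iff.2 hx

/-- Rademacher's theorem together with integration by parts for line derivatives of Lipschitz
functions. -/
lemma hasWeakGradient_gradient_of_lipschitz {C : NNReal} (hv : LipschitzWith C v) (V : Set (E n)) :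
    HasWeakGradient v (gradient v) V ∧ MemLinftyLoc (gradient v) V := by
  have hmeas : Measurable (gradient v) := by
    unfold gradient
    exact (InnerProductSpace.toDual ℝ (E n)).symm.continuous.measurable.comp
      (measurable_fderiv ℝ v)
  have hbd : ∀ x, ‖gradient v x‖ ≤ C := fun x => by
    rw [gradient, LinearIsometryEquiv.norm_map]
    exact norm_fderiv_le_of_lipschitz ℝ hv
  have hmem : ∀ μ : Measure (E n), MemLp (gradient v) ∞ μ := fun μ =>
    memLp_top_of_bound hmeas.aestronglyMeasurable C (.of_forall hbd)
  refine ⟨⟨(hv.continuous.locallyIntegrable).locallyIntegrableOn V,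
    ((hmem volume).locallyIntegrable le_top).locallyIntegrableOn V, fun φ hφ hφc hφV i => ?_⟩,
    fun K _ _ => hmem _⟩
  obtain ⟨D, hD⟩ := ContDiff.lipschitzWith_of_hasCompactSupport hφc hφ (by simp)
  have h1 := LipschitzWith.integral_lineDeriv_mul_eq (μ := volume) hv hD hφc
    (EuclideanSpace.single i (1 : ℝ))
  rw [setIntegral_mul_of_tsupport_subset ((tsupport_fderiv_apply_const_subset φ _).trans hφV),
    setIntegral_mul_of_tsupport_subset hφV]
  have h2 : ∫ x, gradient v x i * φ x =
      ∫ x, lineDeriv ℝ v x (EuclideanSpace.single i 1) * φ x := by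
    refine integral_congr_ae ?_
    filter_upwards [hv.ae_differentiableAt (μ := volume)] with x hx
    have h3 : ∀ w : E n, w i = inner ℝ w (EuclideanSpace.single i (1 : ℝ)) := fun w => by
      simp [EuclideanSpace.inner_single_right]
    rw [h3, gradient, InnerProductSpace.toDual_symm_apply, hx.lineDeriv_eq_fderiv]
  rw [h2, h1, ← integral_neg]
  refine integral_congr_ae (.of_forall fun x => ?_)
  simp only
  rw [(hφ.differentiable (by simp)).differentiableAt.lineDeriv_eq_fderiv, map_neg]
  ring

lemma inner_gradient_le {L : E n → ℝ} (hL : ∀ t : ℝ, 0 ≤ t → ∀ q, L (t • q) = t * L q)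
    (hV : IsOpen V) (hvL : ∀ y ∈ V, ∀ z ∈ V, v y - v z ≤ L (y - z)) {x : E n} (hx : x ∈ V)
    (hd : DifferentiableAt ℝ v x) (q : E n) : inner ℝ (gradient v x) q ≤ L q := by
  rw [gradient, InnerProductSpace.toDual_symm_apply]
  have h1 := (hd.hasFDerivAt.hasLineDerivAt q).tendsto_slope_zero_right
  have h2 : ∀ᶠ t : ℝ in 𝓝[>] 0, x + t • q ∈ V := by
    have hc : Continuous fun t : ℝ => x + t • q := by fun_prop
    have : Tendsto (fun t : ℝ => x + t • q) (𝓝[>] 0) (𝓝 x) := by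
      have h := hc.tendsto 0
      simp only [zero_smul, add_zero] at h
      exact h.mono_left nhdsWithin_le_nhds
    exact this.eventually (hV.mem_nhds hx)
  refine le_of_tendsto h1 ?_
  filter_upwards [h2, self_mem_nhdsWithin] with t ht ht0
  have ht0 : 0 < t := ht0
  have h3 := hvL _ ht x hx
  rw [add_sub_cancel_left, hL t ht0.le] at h3
  rw [smul_eq_mul, inv_mul_le_iff₀ ht0]
  exact h3

variable {H : E n → ℝ}

lemma supFunctional_le_of_lipschitz {C : NNReal} (hv : LipschitzWith C v) {k : ℝ}
    (hK : IsCompact {p | H p ≤ k}) (hne : {p | H p ≤ k}.Nonempty) (hconv : ConvexOn ℝ univ H)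
    (hV : IsOpen V) (hvL : ∀ y ∈ V, ∀ z ∈ V, v y - v z ≤ supportFun {p | H p ≤ k} (y - z)) :
    supFunctional H v V ≤ k := by
  refine ((hasWeakGradient_gradient_of_lipschitz hv V).1.supFunctional_le_iff hV H k).2 ?_
  refine (ae_restrict_iff' hV.measurableSet).2 ?_
  filter_upwards [hv.ae_differentiableAt (μ := volume)] with x hx hxV
  have hconvK : Convex ℝ {p | H p ≤ k} := by simpa using hconv.convex_le k
  exact mem_of_forall_inner_le_supportFun hK hne hconvK
    (inner_gradient_le (fun t ht q => supportFun_smul hK hne ht q) hV hvL hxV hx)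

lemma supFunctional_congr (hV : MeasurableSet V) (huv : EqOn u v V) :
    supFunctional H u V = supFunctional H v V := by
  have : (fun G => HasWeakGradient u G V) = fun G => HasWeakGradient v G V := by
    ext G
    exact ⟨fun h => h.congr hV huv.symm, fun h => h.congr hV huv⟩
  have h2 : weakGrad u V = weakGrad v V := by
    have key : ∀ P Q : (E n → E n) → Prop, P = Q →
        @dite _ (∃ G, P G) (Classical.propDecidable _) (fun h => h.choose) (fun _ => 0) =
          @dite _ (∃ G, Q G) (Classical.propDecidable _) (fun h => h.choose) (fun _ => 0) := by
      rintro P _ rfl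
      rfl
    exact key _ _ this
  rw [supFunctional, supFunctional, h2]

/-- The bound is known only on `V`, so `u` is replaced by a global Lipschitz extension of its
restriction, which leaves the functional on `V` unchanged. -/
lemma supFunctional_le_of_sub_le {k : ℝ} (hK : IsCompact {p | H p ≤ k})
    (hne : {p | H p ≤ k}.Nonempty) (hconv : ConvexOn ℝ univ H) (hV : IsOpen V)
    (huL : ∀ y ∈ V, ∀ z ∈ V, u y - u z ≤ supportFun {p | H p ≤ k} (y - z)) :
    supFunctional H u V ≤ k := by
  obtain ⟨C, hC⟩ := exists_lipschitzWith_of_sub_le hK hne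
  obtain ⟨v, hv, huv⟩ := (hC u V huL).extend_real
  rw [supFunctional_congr hV.measurableSet huv]
  refine supFunctional_le_of_lipschitz hv hK hne hconv hV fun y hy z hz => ?_
  rw [← huv hy, ← huv hz]
  exact huL y hy z hz

end WeakGradient

/-! ### From weak gradient bounds to increments -/

section Mollification

open scoped Convolution

variable {n : ℕ} {u : E n → ℝ} {G : E n → E n} {V : Set (E n)}

/-- The derivative of a mollification of `u` is the mollified weak gradient. -/
lemma HasWeakGradient.fderiv_mollify_le (h : HasWeakGradient u G V) (hV : MeasurableSet V) {q : E n}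
    {c : ℝ} (hq : ∀ᵐ x ∂volume.restrict V, inner ℝ (G x) q ≤ c) {K : Set (E n)} (hKV : K ⊆ V)
    (hu : Integrable (K.indicator u) volume) (φ : ContDiffBump (0 : E n)) {x : E n}
    (hx : Metric.closedBall x φ.rOut ⊆ K) :
    ∃ D : E n →L[ℝ] ℝ, D q ≤ c ∧ HasFDerivAt
      (φ.normed volume ⋆[ContinuousLinearMap.lsmul ℝ ℝ, volume] K.indicator u) D x := by
  set g : E n → ℝ := φ.normed volume with hg
  have hgc : HasCompactSupport g := φ.hasCompactSupport_normed
  have hgs : ContDiff ℝ ∞ g := φ.contDiff_normed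
  have hd := hgc.hasFDerivAt_convolution_right (ContinuousLinearMap.lsmul ℝ ℝ).flip
    hu.locallyIntegrable (hgs.of_le (by simp)) x
  rw [convolution_flip] at hd
  refine ⟨_, ?_, hd⟩
  rw [convolution_precompR_apply _ hu.locallyIntegrable (hgc.fderiv ℝ)
    (hgs.continuous_fderiv (by simp)), convolution_def]
  -- The reflected bump is a test function supported in `K`, so the cut-off is invisible to it and
  -- the weak gradient identity applies. The bound by `c` survives since `ψ` is nonnegative with
  -- integral one.
  set ψ : E n → ℝ := fun s => g (x - s) with hψ
  have hψs : ContDiff ℝ ∞ ψ := hgs.comp (contDiff_const.sub contDiff_id)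
  have hψsupp : tsupport ψ ⊆ Metric.closedBall x φ.rOut := by
    refine closure_minimal ?_ Metric.isClosed_closedBall
    intro s hs
    have h1 : x - s ∈ Function.support g := hs
    rw [hg, φ.support_normed_eq, mem_ball_zero_iff] at h1
    rw [Metric.mem_closedBall', dist_eq_norm]
    exact h1.le
  have hψc : HasCompactSupport ψ :=
    (isCompact_closedBall x φ.rOut).of_isClosed_subset (isClosed_tsupport ψ) hψsupp
  have hψK : tsupport ψ ⊆ K := hψsupp.trans hx
  have hfd : ∀ t, fderiv ℝ ψ t q = -fderiv ℝ g (x - t) q := by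
    intro t
    have h1 : HasFDerivAt ψ ((fderiv ℝ g (x - t)).comp (-ContinuousLinearMap.id ℝ (E n))) t :=
      (hgs.differentiable (by simp) (x - t)).hasFDerivAt.comp t ((hasFDerivAt_id t).const_sub x)
    rw [h1.fderiv]
    simp
  have h1 : ∀ t, (ContinuousLinearMap.lsmul ℝ ℝ).flip (K.indicator u t) (fderiv ℝ g (x - t) q) =
      -(u t * fderiv ℝ ψ t q) := by
    intro t
    rw [ContinuousLinearMap.flip_apply, ContinuousLinearMap.lsmul_apply, smul_eq_mul]
    by_cases ht : t ∈ K
    · rw [indicator_of_mem ht, hfd]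
      ring
    · have h2 : fderiv ℝ ψ t q = 0 := by
        have := image_eq_zero_of_notMem_tsupport (f := fun t => fderiv ℝ ψ t q) (x := t)
          fun h => ht (hψK (tsupport_fderiv_apply_const_subset ψ q h))
        exact this
      rw [indicator_of_notMem ht, h2, mul_zero, mul_zero, neg_zero]
  simp_rw [h1]
  rw [integral_neg, h.integral_mul_fderiv hψs hψc (hψK.trans hKV) q, neg_neg]
  have hψint : ∫ t, ψ t = 1 := by
    rw [hψ, integral_sub_left_eq_self g volume x]
    exact φ.integral_normed
  have hψ0 : ∀ t, 0 ≤ ψ t := fun t => φ.nonneg_normed _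
  calc ∫ t, inner ℝ (G t) q * ψ t ≤ ∫ t, c * ψ t := by
        refine integral_mono_ae (integrable_mul_of_tsupport_subset
          (locallyIntegrableOn_inner_const h.2.1 q) hψs.continuous hψc (hψK.trans hKV))
          ((hψs.continuous.integrable_of_hasCompactSupport hψc).const_mul c) ?_
        filter_upwards [(ae_restrict_iff' hV).1 hq] with t ht
        by_cases htV : t ∈ V
        · exact mul_le_mul_of_nonneg_right (ht htV) (hψ0 t)
        · have h3 : ψ t = 0 := image_eq_zero_of_notMem_tsupport fun h => htV (hKV (hψK h))
          simp [h3]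
    _ = c := by rw [integral_const_mul, hψint, mul_one]

/-- A one-sided bound on a weak directional derivative bounds the increments along segments. -/
lemma HasWeakGradient.sub_le_of_segment_subset (h : HasWeakGradient u G V) (hV : IsOpen V)
    (hu : ContinuousOn u V) {y z : E n} {c : ℝ}
    (hq : ∀ᵐ x ∂volume.restrict V, inner ℝ (G x) (y - z) ≤ c) (hseg : segment ℝ z y ⊆ V) :
    u y - u z ≤ c := by
  have hsc : IsCompact (segment ℝ z y) := by
    rw [segment_eq_image_lineMap]
    exact isCompact_Icc.image (by fun_prop)
  obtain ⟨δ, hδ, hδV⟩ := hsc.exists_cthickening_subset_open hV hseg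
  set K := Metric.cthickening δ (segment ℝ z y) with hK
  have hKc : IsCompact K := hsc.cthickening
  have hui : Integrable (K.indicator u) volume :=
    (integrable_indicator_iff hKc.measurableSet).2 ((hu.mono hδV).integrableOn_compact hKc)
  have hball : ∀ x ∈ segment ℝ z y, Metric.closedBall x δ ⊆ K := fun x hx =>
    Metric.closedBall_subset_cthickening hx δ
  -- Radii at most `δ` keep the bumps centred on the segment inside the thickening `K ⊆ V`.
  set φ : ℕ → ContDiffBump (0 : E n) := fun i =>
    ⟨δ / (i + 1) / 2, δ / (i + 1), by positivity, half_lt_self (by positivity)⟩ with hφ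
  have hφlim : Tendsto (fun i => (φ i).rOut) atTop (𝓝 0) := by
    have := (tendsto_one_div_add_atTop_nhds_zero_nat (𝕜 := ℝ)).const_mul δ
    simpa [hφ, div_eq_mul_inv] using this
  have hφδ : ∀ i, (φ i).rOut ≤ δ := fun i =>
    div_le_self hδ.le (by linarith [Nat.cast_nonneg (α := ℝ) i])
  set w : ℕ → E n → ℝ := fun i =>
    (φ i).normed volume ⋆[ContinuousLinearMap.lsmul ℝ ℝ, volume] K.indicator u with hw
  have hwlim : ∀ x ∈ segment ℝ z y, Tendsto (fun i => w i x) atTop (𝓝 (u x)) := by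
    intro x hx
    refine ContDiffBump.convolution_tendsto_right (g := fun _ => K.indicator u)
      (k := fun _ => x) hφlim (.of_forall fun _ => hui.aestronglyMeasurable) ?_ tendsto_const_nhds
    have h1 : ContinuousAt (K.indicator u) x := by
      refine (hu.continuousAt (hV.mem_nhds (hseg hx))).congr ?_
      filter_upwards [Metric.closedBall_mem_nhds x hδ] with s hs
      rw [indicator_of_mem (hball x hx hs)]
    have h2 : K.indicator u x = u x :=
      indicator_of_mem (hball x hx (Metric.mem_closedBall_self hδ.le)) u
    rw [← h2]
    exact h1.tendsto.comp tendsto_snd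
  have hwle : ∀ i, w i y - w i z ≤ c := by
    intro i
    set γ : ℝ → E n := fun t => z + t • (y - z) with hγ
    have hγseg : ∀ t ∈ Icc (0 : ℝ) 1, γ t ∈ segment ℝ z y := by
      intro t ht
      rw [segment_eq_image']
      exact ⟨t, ht, rfl⟩
    have hder : ∀ t ∈ Icc (0 : ℝ) 1, ∃ d ≤ c, HasDerivAt (fun t => w i (γ t)) d t := by
      intro t ht
      obtain ⟨D, hDc, hD⟩ := h.fderiv_mollify_le hV.measurableSet hq hδV hui (φ i)
        ((Metric.closedBall_subset_closedBall (hφδ i)).trans (hball _ (hγseg t ht)))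
      refine ⟨D (y - z), hDc, ?_⟩
      have h1 : HasDerivAt γ (y - z) t := by
        have := ((hasDerivAt_id t).smul_const (y - z)).const_add z
        rw [one_smul] at this
        exact this
      exact hD.comp_hasDerivAt t h1
    have hmv := (convex_Icc (0 : ℝ) 1).image_sub_le_mul_sub_of_deriv_le
      (f := fun t => w i (γ t)) (C := c)
      (fun t ht => by
        obtain ⟨d, -, hd⟩ := hder t ht
        exact hd.continuousAt.continuousWithinAt)
      (fun t ht => by
        obtain ⟨d, -, hd⟩ := hder t (interior_subset ht)
        exact hd.differentiableAt.differentiableWithinAt)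
      (fun t ht => by
        obtain ⟨d, hdc, hd⟩ := hder t (interior_subset ht)
        rwa [hd.deriv]) 0 (by simp) 1 (by simp) zero_le_one
    simpa [hγ] using hmv
  exact le_of_tendsto' ((hwlim y (right_mem_segment ℝ z y)).sub
    (hwlim z (left_mem_segment ℝ z y))) hwle

end Mollification

/-! ### Absolute minimizers and the critical level -/

section Main

variable {n : ℕ} {u : E n → ℝ} {G : E n → E n} {V Ω : Set (E n)} {H : E n → ℝ}

lemma HasWeakGradient.sub_le_supportFun (h : HasWeakGradient u G V) (hV : IsOpen V)
    (hu : ContinuousOn u V) {k : ℝ} (hK : IsCompact {p | H p ≤ k})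
    (hG : ∀ᵐ x ∂volume.restrict V, H (G x) ≤ k) {y z : E n} (hseg : segment ℝ z y ⊆ V) :
    u y - u z ≤ supportFun {p | H p ≤ k} (y - z) :=
  h.sub_le_of_segment_subset hV hu
    (hG.mono fun _ hx => inner_le_supportFun hK hx (y - z)) hseg

/-- The slope bound makes `v` an admissible Lipschitz competitor with functional at most `k`;
minimality transfers this to `u`, and mollification returns to increments. Only segments inside `W`
are reached, since `W` need not be convex. -/
lemma IsAbsoluteMinimizer.isSlopeMinimizer (hu : IsAbsoluteMinimizer H Ω u)
    (hK : ∀ k, IsCompact {p | H p ≤ k}) (hconv : ConvexOn ℝ univ H) :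
    IsSlopeMinimizer H Ω u where
  continuousOn := hu.continuousOn
  sub_le := by
    intro W hW hWc hWΩ k hne v hv hvu y z hseg
    obtain ⟨-, G, hG, -⟩ := hu.memW1inftyLoc
    have hWΩ' := subset_closure.trans hWΩ
    obtain ⟨C, hC⟩ := exists_lipschitzWith_of_sub_le (hK k) hne
    have hvC := lipschitzOnWith_univ.1 (hC v univ fun y _ z _ => hv y z)
    obtain ⟨hvG, hvG'⟩ := hasWeakGradient_gradient_of_lipschitz hvC W
    have hmin := hu.le_of_eq_on_frontier W hW hWc hWΩ v
      ⟨fun K hKc _ => by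
        obtain ⟨M, hM⟩ := hKc.exists_bound_of_continuousOn hvC.continuous.continuousOn
        exact memLp_top_of_bound hvC.continuous.aestronglyMeasurable M
          ((ae_restrict_iff' hKc.measurableSet).2 (.of_forall hM)), _, hvG, hvG'⟩
      hvC.continuous.continuousOn hvu
    have hle := hmin.trans (supFunctional_le_of_lipschitz hvC (hK k) hne hconv hW
      fun y _ z _ => hv y z)
    have hGW := hG.mono hWΩ'
    exact hGW.sub_le_supportFun hW (hu.continuousOn.mono hWΩ') (hK k)
      ((hGW.supFunctional_le_iff hW H k).1 hle) hseg

lemma mem_slopeLevels_of_ae_le (h : HasWeakGradient u G Ω) (hu : ContinuousOn u Ω) {k : ℝ}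
    (hK : IsCompact {p | H p ≤ k}) {x : E n} {r : ℝ} (hr : 0 < r) (hΩ : Metric.ball x r ⊆ Ω)
    (hG : ∀ᵐ y ∂volume.restrict (Metric.ball x r), H (G y) ≤ k) : k ∈ slopeLevels H u x := by
  refine ⟨?_, r, hr, fun y hy z hz => (h.mono hΩ).sub_le_supportFun Metric.isOpen_ball
    (hu.mono hΩ) hK hG ((convex_ball x r).segment_subset hz hy)⟩
  have : (ae (volume.restrict (Metric.ball x r))).NeBot := by
    rw [ae_neBot, Ne, Measure.restrict_eq_zero]
    exact (Metric.measure_ball_pos volume x hr).ne'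
  obtain ⟨y, hy⟩ := hG.exists
  exact ⟨G y, hy⟩

/-- Local boundedness of the weak gradient makes some level admissible; the minimum of `H` bounds
the levels below, as an admissible sublevel set is nonempty. -/
lemma exists_isGLB_slopeLevels (hu : MemW1inftyLoc u Ω) (huc : ContinuousOn u Ω) (hΩ : IsOpen Ω)
    (hc : Continuous H) (hK : ∀ k, IsCompact {p | H p ≤ k}) {x : E n} (hx : x ∈ Ω) :
    ∃ κ, IsGLB (slopeLevels H u x) κ := by
  obtain ⟨-, G, hG, hGloc⟩ := hu
  refine ⟨sInf (slopeLevels H u x), isGLB_csInf ?_ ?_⟩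
  · obtain ⟨r, hrΩ, hr⟩ :=
      ((eventually_closedBall_subset hΩ hx).and self_mem_nhdsWithin).exists
    have hr : 0 < r := hr
    obtain ⟨M, hM⟩ : ∃ M : ℝ, ∀ᵐ y ∂volume.restrict (Metric.closedBall x r), ‖G y‖ ≤ M := by
      have h1 := hGloc _ (isCompact_closedBall x r) hrΩ
      refine ⟨(eLpNorm G ∞ (volume.restrict (Metric.closedBall x r))).toReal, ?_⟩
      filter_upwards [ae_le_eLpNormEssSup (f := G)
        (μ := volume.restrict (Metric.closedBall x r))] with y hy
      rw [← eLpNorm_exponent_top] at hy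
      rw [← toReal_enorm]
      exact ENNReal.toReal_mono h1.2.ne hy
    obtain ⟨k, hk⟩ := ((isCompact_closedBall (0 : E n) M).image hc).bddAbove
    refine ⟨k, mem_slopeLevels_of_ae_le hG huc (hK k) hr
      (Metric.ball_subset_closedBall.trans hrΩ) ?_⟩
    refine ae_restrict_of_ae_restrict_of_subset Metric.ball_subset_closedBall ?_
    filter_upwards [hM] with y hy
    exact hk ⟨G y, by simpa using hy, rfl⟩
  · have h0 : (0 : E n) ∈ {p | H p ≤ H 0} := le_refl (H 0)
    obtain ⟨p, -, hp⟩ := (hK (H 0)).exists_isMinOn ⟨0, h0⟩ hc.continuousOn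
    refine ⟨min (H p) (H 0), fun k hk => ?_⟩
    obtain ⟨⟨q, hq⟩, -⟩ := hk
    rcases le_total (H q) (H 0) with hq0 | hq0
    · exact (min_le_left _ _).trans ((hp hq0).trans hq)
    · exact (min_le_right _ _).trans (hq0.trans hq)

/-- An essential supremum below `κ` on a ball would give an admissible level below `κ`; conversely,
each level above `κ` is admissible and bounds the functional on small balls. -/
lemma tendsto_supFunctional_ball (hu : MemW1inftyLoc u Ω) (huc : ContinuousOn u Ω) (hΩ : IsOpen Ω)
    (hK : ∀ k, IsCompact {p | H p ≤ k}) (hconv : ConvexOn ℝ univ H) {x : E n}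
    (hx : x ∈ Ω) {κ : ℝ} (hκ : IsGLB (slopeLevels H u x) κ) :
    Tendsto (fun r : ℝ => supFunctional H u (Metric.ball x r)) (𝓝[>] 0) (𝓝 (κ : EReal)) := by
  obtain ⟨-, G, hG, -⟩ := hu
  refine tendsto_order.2 ⟨fun a ha => ?_, fun a ha => ?_⟩
  · obtain ⟨k, hak, hkκ⟩ := EReal.lt_iff_exists_real_btwn.1 ha
    filter_upwards [eventually_closedBall_subset hΩ hx, self_mem_nhdsWithin] with r hrΩ hr
    have hrΩ := Metric.ball_subset_closedBall.trans hrΩ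
    by_contra! hcon
    have h1 := ((hG.mono hrΩ).supFunctional_le_iff Metric.isOpen_ball H k).1 (hcon.trans hak.le)
    exact absurd (hκ.1 (mem_slopeLevels_of_ae_le hG huc (hK k) hr hrΩ h1))
      (not_le.2 (EReal.coe_lt_coe_iff.1 hkκ))
  · obtain ⟨k, hκk, hka⟩ := EReal.lt_iff_exists_real_btwn.1 ha
    obtain ⟨hne, δ, hδ, h⟩ := mem_slopeLevels_of_isGLB hK hκ (EReal.coe_lt_coe_iff.1 hκk)
    filter_upwards [Ioo_mem_nhdsGT hδ] with r hr
    have hsub : Metric.ball x r ⊆ Metric.ball x δ := Metric.ball_subset_ball hr.2.le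
    exact (supFunctional_le_of_sub_le (hK k) hne hconv Metric.isOpen_ball
      fun y hy z hz => h y (hsub hy) z (hsub hz)).trans_lt hka

lemma LinearApproxAlong.unique {x : E n} {r : ℕ → ℝ} {e e' : E n}
    (h : LinearApproxAlong u x r e) (h' : LinearApproxAlong u x r e') : e = e' := by
  have key : ∀ {e : E n}, LinearApproxAlong u x r e → ∀ y ∈ Metric.ball (0 : E n) 1,
      Tendsto (fun k => (u (x + r k • y) - u x) / r k) atTop (𝓝 (inner ℝ e y)) := by
    intro e h y hy
    have h1 : Tendsto (fun k => ENNReal.ofReal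
        |(u (x + r k • y) - u x) / r k - inner ℝ e y|) atTop (𝓝 0) :=
      tendsto_of_tendsto_of_tendsto_of_le_of_le tendsto_const_nhds h (fun _ => zero_le)
        fun k => le_iSup₂ (f := fun y (_ : y ∈ Metric.ball (0 : E n) 1) =>
          ENNReal.ofReal |(u (x + r k • y) - u x) / r k - inner ℝ e y|) y hy
    have h2 := (ENNReal.tendsto_toReal ENNReal.zero_ne_top).comp h1
    rw [ENNReal.toReal_zero] at h2
    refine tendsto_sub_nhds_zero_iff.1 (squeeze_zero_norm (fun k => ?_) h2)
    rw [Function.comp_apply, ENNReal.toReal_ofReal (abs_nonneg _), Real.norm_eq_abs]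
  obtain ⟨s, hs0, hs1⟩ : ∃ s : ℝ, 0 < s ∧ s * ‖e - e'‖ < 1 := by
    refine ⟨(‖e - e'‖ + 1)⁻¹, by positivity, ?_⟩
    rw [inv_mul_lt_iff₀ (by positivity)]
    linarith
  have hy : s • (e - e') ∈ Metric.ball (0 : E n) 1 := by
    rwa [mem_ball_zero_iff, norm_smul, Real.norm_of_nonneg hs0.le]
  have h1 := tendsto_nhds_unique (key h _ hy) (key h' _ hy)
  rw [inner_smul_right, inner_smul_right] at h1
  have h2 := mul_left_cancel₀ hs0.ne' h1
  rw [← sub_eq_zero, ← inner_sub_left, inner_self_eq_zero] at h2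
  exact sub_eq_zero.1 h2

end Main

end AbsMin
end

theorem theorem1p1 (n : ℕ) (hn : 2 ≤ n) (H : AbsMin.E n → ℝ)
    (hHcont : Continuous H) (hHconv : ConvexOn ℝ univ H)
    (hHcoer : Tendsto H (Bornology.cobounded (AbsMin.E n)) atTop)
    (hA : ∀ c : ℝ, ∀ a b : AbsMin.E n, a ≠ b → ¬ segment ℝ a b ⊆ H ⁻¹' {c})
    (Ω : Set (AbsMin.E n)) (hΩ : IsOpen Ω)
    (u : AbsMin.E n → ℝ) (hu : AbsMin.IsAbsoluteMinimizer H Ω u) :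
    ∀ x ∈ Ω, AbsMin.LinearApproxPropertyAt u x ∧
      ∀ e ∈ AbsMin.blowUpSlopes u x,
        Tendsto (fun r : ℝ => AbsMin.supFunctional H u (Metric.ball x r)) (𝓝[>] 0)
          (𝓝 ((H e : ℝ) : EReal)) := by
  intro x hx
  have : Nonempty (Fin n) := ⟨⟨0, by omega⟩⟩
  have : Nontrivial (AbsMin.E n) := inferInstance
  have hK := AbsMin.isCompact_sublevel hHcont hHcoer
  obtain ⟨κ, hκ⟩ := AbsMin.exists_isGLB_slopeLevels hu.memW1inftyLoc hu.continuousOn hΩ hHcont hK hx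
  have hblow : ∀ r : ℕ → ℝ, (∀ i, 0 < r i) → Tendsto r atTop (𝓝 0) →
      ∃ φ : ℕ → ℕ, StrictMono φ ∧ ∃ e, H e = κ ∧ AbsMin.LinearApproxAlong u x (r ∘ φ) e :=
    fun r hr hr0 => (hu.isSlopeMinimizer hK hHconv).exists_subseq_tendsto hHcont hHconv hK hA hΩ hx
      hκ (tendsto_nhdsWithin_iff.2 ⟨hr0, .of_forall hr⟩)
  refine ⟨fun r hr hr0 => ?_, ?_⟩
  · obtain ⟨φ, hφ, e, -, he⟩ := hblow r hr hr0
    exact ⟨φ, hφ, e, he⟩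
  · rintro e ⟨r, hr, hr0, her⟩
    -- A given slope `e` is compared with a blow-up along a subsequence of its own scales, whose
    -- slope has `H e' = κ`; uniqueness of the linear approximation identifies the two.
    obtain ⟨φ, hφ, e', he', hlim⟩ := hblow r hr hr0
    have hee' : e = e' :=
      AbsMin.LinearApproxAlong.unique (r := r ∘ φ) (her.comp hφ.tendsto_atTop) hlim
    rw [hee', he']
    exact AbsMin.tendsto_supFunctional_ball hu.memW1inftyLoc hu.continuousOn hΩ hK hHconv hx hκ
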